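/- Let $\bar\nu:(0,\infty)\to[0,\infty)$ be completely monotone with $\int_0^\infty (s\wedge 1)\,\bar\nu(s)\,ds<\infty$, and let $$\varphi(z)=\int_0^\infty (1-e^{-sz})\,\bar\nu(s)\,ds,\qquad \operatorname{Re} z\ge 0,$$ be the corresponding complete Bernstein function (with zero killing rate and zero drift), extended to the closed right half-plane. Assume * **(C)** $\varphi(\theta)\to 0$ as $\theta\to 0^+$ and $\varphi(\theta)\to\infty$ as $\theta\to\infty$; * **(K)** $\varphi(\theta)/\theta\to\infty$ as $\theta\to 0^+$ and $\varphi(\theta)/\theta\to 0$ as $\theta\to\infty$. Let $\nu(x)=\int_x^\infty\bar\nu(z)\,dz$ for $x>0$ and $\nu(x)=0$ for $x\le 0$. Let $\kappa\ge 0$ be the associated Sonine kernel: it is locally integrable on $[0,\infty)$ and $\int_0^t\nu(z)\kappa(t-z)\,dz=1$ for all $t>0$. Put $\chi(x)=\int_0^x\kappa(z)\,dz$ for $x>0$ and $\chi(x)=0$ for $x\le 0$. For a function $g$ on $(0,\infty)$ write $(I_-^{(g)}f)(x)=\int_x^\infty f(t)\,g(t-x)\,dt$, and write $x_+=\max(x,0)$.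 Consider one of the following two cases. * *Derivative case.* Assume **(A1)** $\bar\nu\in L^2(1,\infty)$ and **(A2)** $\nu\in L^2(0,1)\cap L^p(1,\infty)$ for some $p\ge 1$. Put $\mathcal M_-^{(\varphi)}f=-\sqrt{C_\nu}\,\frac{d}{dx}I_-^{(\nu)}f$ (derivative in the sense of distributions), where $C_\nu=\big(\int_{\mathbb R}[\nu((1-u)_+)-\nu((-u)_+)]^2du\big)^{-1}$, and $A_\varphi(x)=|\varphi(ix)|^2$. * *Integral case.* Assume, for every $\varepsilon>0$, **(B1)** $\kappa\in L^1(0,\varepsilon)\cap L^2(\varepsilon,\infty)$ and **(B2)** $\chi\in L^2(0,\varepsilon)$. Put $\mathcal M_-^{(\varphi)}f=\sqrt{C_\kappa}\,I_-^{(\kappa)}f$, where $C_\kappa=\big(\int_{\mathbb R}[\chi((1-u)_+)-\chi((-u)_+)]^2du\big)^{-1}$, and $A_\varphi(x)=|\varphi(ix)|^{-2}$. Let $\mathcal S'(\mathbb R)$ be the space of real tempered distributions with its cylindrical $\sigma$-algebra, and let $\mu$ be the white noise measure on it, that is, the probability measure with $\int e^{i\langle u,\xi\rangle}d\mu(u)=e^{-\frac12\|\xi\|_{L^2}^2}$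 for all $\xi\in\mathcal S(\mathbb R)$. Extend $\xi\mapsto\langle\cdot,\xi\rangle$ by continuity to a map $L^2(\mathbb R)\to L^2(\mu)$. Let $X_\varphi(1_{[0,t)})=\langle\cdot,\mathcal M_-^{(\varphi)}1_{[0,t)}\rangle$, $t\ge 0$. **Theorem.** Suppose that for some constants $C>0$ and $\beta\in(0,1)$ $$\int_{\mathbb R}\frac{A_\varphi(xa)}{x^2}\,(1-\cos x)\,dx\ \ge\ C\,a^{\beta}\qquad\text{for all } a>0.$$ Then $\mathcal M_-^{(\varphi)}1_{[0,t)}\in L^2(\mathbb R)$ for all $t\ge0$, the process $t\mapsto X_\varphi(1_{[0,t)})$ has a version that is jointly measurable in $(t,\omega)$, and every jointly measurable version possesses a local time. That is, for $\mu$-almost every $\omega$ there is a function $L([0,t],x)\ge 0$ ($t\ge 0$, $x\in\mathbb R$), measurable in $x$, with $$\int_0^t 1_{\{X_\varphi(1_{[0,s)})(\omega)\in A\}}\,ds=\int_A L([0,t],x)\,dx\qquad\text{for all } t\ge 0 \text{ and all Borel } A\subseteq\mathbb R,$$ such that $t\mapsto L([0,t],x)$ is continuous on $[0,\infty)$ for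 almost every $x\in\mathbb R$, and $\int_{\mathbb R}L([0,t],x)^2\,dx<\infty$ for every $t\ge 0$. -/

import Mathlib

open Set Filter Topology MeasureTheory
open scoped ContDiff SchwartzMap

noncomputable section

namespace BGM

/-! ### Complete Bernstein functions -/

/-- Complete monotonicity on `(0, ∞)`. Only the values on `(0, ∞)` matter. -/
def IsCompletelyMonotone (f : ℝ → ℝ) : Prop :=
  ContDiffOn ℝ ∞ f (Ioi 0) ∧
    ∀ n : ℕ, ∀ x : ℝ, 0 < x → 0 ≤ (-1 : ℝ) ^ n * iteratedDerivWithin n f (Ioi 0) x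

/-- `νbar` is the density of the Lévy measure of a complete Bernstein function: it is completely
monotone and `∫₀^∞ (s ∧ 1) νbar(s) ds < ∞`. -/
def IsCompleteLevyDensity (νbar : ℝ → ℝ) : Prop :=
  IsCompletelyMonotone νbar ∧ IntegrableOn (fun s => min s 1 * νbar s) (Ioi 0) volume

/-- The Bernstein function `φ(x) = ∫₀^∞ (1 - e^{-s x}) νbar(s) ds` with Lévy density `νbar`,
zero killing rate and zero drift. -/
def bernstein (νbar : ℝ → ℝ) (x : ℝ) : ℝ :=
  ∫ s in Ioi (0 : ℝ), (1 - Real.exp (-(s * x))) * νbar s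

/-- The extension of the Bernstein function to the closed right half-plane. -/
def bernsteinExt (νbar : ℝ → ℝ) (z : ℂ) : ℂ :=
  ∫ s in Ioi (0 : ℝ), (1 - Complex.exp (-((s : ℂ) * z))) * (νbar s : ℂ)

theorem bernsteinExt_ofReal (νbar : ℝ → ℝ) (x : ℝ) :
    bernsteinExt νbar (x : ℂ) = (bernstein νbar x : ℂ) := by
  unfold bernsteinExt bernstein
  rw [← integral_complex_ofReal]
  congr 1
  funext s
  simp

/-- Condition (C): `φ(θ) → 0` as `θ → 0+` and `φ(θ) → ∞` as `θ → ∞`. -/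
def CondC (νbar : ℝ → ℝ) : Prop :=
  Tendsto (bernstein νbar) (𝓝[>] 0) (𝓝 0) ∧ Tendsto (bernstein νbar) atTop atTop

/-- Condition (K): `φ(θ)/θ → ∞` as `θ → 0+` and `φ(θ)/θ → 0` as `θ → ∞`. -/
def CondK (νbar : ℝ → ℝ) : Prop :=
  Tendsto (fun θ => bernstein νbar θ / θ) (𝓝[>] 0) atTop ∧
    Tendsto (fun θ => bernstein νbar θ / θ) atTop (𝓝 0)

/-- The tail `ν(x) = ∫_x^∞ νbar(z) dz` for `x > 0`, extended by `0` to `x ≤ 0`. -/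
def levyTail (νbar : ℝ → ℝ) (x : ℝ) : ℝ :=
  if 0 < x then ∫ z in Ioi x, νbar z else 0

/-- `κ` is a Sonine kernel associated with `ν`: nonnegative on `(0, ∞)`, integrable on every
`(0, T)`, and `∫₀^t ν(z) κ(t - z) dz = 1` for all `t > 0`. -/
def IsSonineKernel (ν κ : ℝ → ℝ) : Prop :=
  (∀ x, 0 < x → 0 ≤ κ x) ∧
  (∀ T, 0 < T → IntegrableOn κ (Ioo 0 T) volume) ∧
  ∀ t, 0 < t → IntegrableOn (fun z => ν z * κ (t - z)) (Ioo 0 t) volume ∧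
    ∫ z in Ioo 0 t, ν z * κ (t - z) = 1

/-- The primitive `χ(x) = ∫₀^x κ(z) dz` for `x > 0`, extended by `0` to `x ≤ 0`. -/
def soninePrimitive (κ : ℝ → ℝ) (x : ℝ) : ℝ :=
  ∫ z in Ioo 0 x, κ z

/-- The derivative case: `νbar ∈ L²(1, ∞)`, and `ν ∈ L²(0, 1) ∩ L^p(1, ∞)` for some `p ≥ 1`. -/
def CondA (νbar : ℝ → ℝ) : Prop :=
  MemLp νbar 2 (volume.restrict (Ioi 1)) ∧
  MemLp (levyTail νbar) 2 (volume.restrict (Ioo 0 1)) ∧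
  ∃ p : ℝ, 1 ≤ p ∧ MemLp (levyTail νbar) (ENNReal.ofReal p) (volume.restrict (Ioi 1))

/-- The integral case: `κ ∈ L¹(0, ε) ∩ L²(ε, ∞)` and `χ ∈ L²(0, ε)` for every `ε > 0`. -/
def CondB (κ : ℝ → ℝ) : Prop :=
  ∀ ε : ℝ, 0 < ε →
    MemLp κ 1 (volume.restrict (Ioo 0 ε)) ∧
    MemLp κ 2 (volume.restrict (Ioi ε)) ∧
    MemLp (soninePrimitive κ) 2 (volume.restrict (Ioo 0 ε))

/-! ### Generalized fractional operators -/

/-- The right-sided convolution operator `(I_-^{(g)} f)(x) = ∫_x^∞ f(t) g(t - x) dt`. -/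
def rightIntegral (g f : ℝ → ℝ) (x : ℝ) : ℝ :=
  ∫ t in Ioi x, f t * g (t - x)

/-- The locally integrable function `h` equals `-d/dx I_-^{(g)} f` in the sense of
distributions. -/
def IsRightDerivative (g f h : ℝ → ℝ) : Prop :=
  LocallyIntegrable (rightIntegral g f) volume ∧ LocallyIntegrable h volume ∧
    ∀ q : ℝ → ℝ, ContDiff ℝ ∞ q → HasCompactSupport q →
      ∫ x, h x * q x = ∫ x, rightIntegral g f x * deriv q x

/-- The distributional derivative determines the function almost everywhere. -/
theorem IsRightDerivative.ae_eq {g f h₁ h₂ : ℝ → ℝ} (H₁ : IsRightDerivative g f h₁)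
    (H₂ : IsRightDerivative g f h₂) : h₁ =ᵐ[volume] h₂ := by
  refine ae_eq_of_integral_contDiff_smul_eq H₁.2.1 H₂.2.1 fun q hq hq' => ?_
  have h1 := H₁.2.2 q hq hq'
  have h2 := H₂.2.2 q hq hq'
  simp only [smul_eq_mul]
  simp only [mul_comm (q _)]
  rw [h1, h2]

open Classical in
/-- The right-sided generalized Riemann–Liouville derivative
`D_-^{(g)} f = -d/dx I_-^{(g)} f` (distributional derivative), as a function when the
derivative is one; it is determined up to null sets, and `0` is the default otherwise. -/
def rightDerivative (g f : ℝ → ℝ) : ℝ → ℝ :=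
  if H : ∃ h, IsRightDerivative g f h then H.choose else 0

/-- The constant `(∫ [g((1-u)₊) - g((-u)₊)]² du)⁻¹`: it is `C_ν` for `g = ν`, and `C_κ` for
`g = χ`. -/
def normConst (g : ℝ → ℝ) : ℝ :=
  (∫ u : ℝ, (g (max (1 - u) 0) - g (max (-u) 0)) ^ 2)⁻¹

/-- The operator `M_-^{(ν)} = √C_ν · D_-^{(ν)}`. -/
def opNu (νbar : ℝ → ℝ) (f : ℝ → ℝ) (x : ℝ) : ℝ :=
  √(normConst (levyTail νbar)) * rightDerivative (levyTail νbar) f x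

/-- The operator `M_-^{(κ)} = √C_κ · I_-^{(κ)}`. -/
def opKappa (κ : ℝ → ℝ) (f : ℝ → ℝ) (x : ℝ) : ℝ :=
  √(normConst (soninePrimitive κ)) * rightIntegral κ f x

/-- `A_φ` in the derivative case: `(Re φ(ix))² + (Im φ(ix))²`. -/
def ampNu (νbar : ℝ → ℝ) (x : ℝ) : ℝ :=
  (bernsteinExt νbar (Complex.I * x)).re ^ 2 + (bernsteinExt νbar (Complex.I * x)).im ^ 2

/-- `A_φ` in the integral case: `[(Re φ(ix))² + (Im φ(ix))²]⁻¹`. -/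
def ampKappa (νbar : ℝ → ℝ) (x : ℝ) : ℝ :=
  (ampNu νbar x)⁻¹

/-- The lower bound `∫ A(xa) (1 - cos x) / x² dx ≥ C a^β` for all `a > 0`. -/
def LowerBound (A : ℝ → ℝ) (C β : ℝ) : Prop :=
  ∀ a : ℝ, 0 < a → C * a ^ β ≤ ∫ x : ℝ, A (x * a) / x ^ 2 * (1 - Real.cos x)

/-! ### White noise -/

/-- The space `S'(ℝ)` of real tempered distributions. -/
abbrev SchwartzDual : Type := 𝓢(ℝ, ℝ) →L[ℝ] ℝ

/-- The cylindrical σ-algebra on `S'(ℝ)`. -/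
instance instMeasurableSpaceSchwartzDual : MeasurableSpace SchwartzDual :=
  ⨆ ξ : 𝓢(ℝ, ℝ), MeasurableSpace.comap (fun u : SchwartzDual => u ξ) (borel ℝ)

/-- The white noise measure: the probability measure on `S'(ℝ)` with characteristic functional
`ξ ↦ exp(-‖ξ‖²/2)`, where the norm is that of `L²(ℝ)`. -/
structure IsWhiteNoise (μ : Measure SchwartzDual) : Prop where
  isProbabilityMeasure : IsProbabilityMeasure μ
  charFunctional : ∀ ξ : 𝓢(ℝ, ℝ),
    ∫ u, Complex.exp (Complex.I * ((u ξ : ℝ) : ℂ)) ∂μ =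
      Complex.exp (-(1 / 2 : ℂ) * ((∫ x : ℝ, ξ x ^ 2 : ℝ) : ℂ))

/-- `Y` is a representative of the pairing `⟨·, f⟩`, for `f ∈ L²(ℝ)`: the pairing is the
continuous extension of `ξ ↦ ⟨·, ξ⟩` from `S(ℝ) ⊆ L²(ℝ)` to `L²(ℝ)`, with values in `L²(μ)`. -/
structure IsPairing (μ : Measure SchwartzDual) (f : ℝ → ℝ) (Y : SchwartzDual → ℝ) : Prop where
  memLp : MemLp f 2 volume
  memLp_pairing : MemLp Y 2 μ
  tendsto : ∀ ξ : ℕ → 𝓢(ℝ, ℝ),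
    Tendsto (fun n => eLpNorm (fun x => ξ n x - f x) 2 volume) atTop (𝓝 0) →
      Tendsto (fun n => eLpNorm (fun u : SchwartzDual => u (ξ n) - Y u) 2 μ) atTop (𝓝 0)

/-- `X` is a jointly measurable version of the process
`X_φ(1_{[0,t)}) = ⟨·, M 1_{[0,t)}⟩`, `t ≥ 0`, for the operator `M`. -/
structure IsBGProcess (μ : Measure SchwartzDual) (M : (ℝ → ℝ) → ℝ → ℝ)
    (X : ℝ → SchwartzDual → ℝ) : Prop where
  measurable : Measurable (Function.uncurry X)
  pairing : ∀ t : ℝ, 0 ≤ t → IsPairing μ (M ((Ico 0 t).indicator 1)) (X t)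

/-! ### Local times -/

/-- The occupation measure `A ↦ ∫_B 1_{x(s) ∈ A} ds` of a measurable path `x`. -/
def occupationMeasure (x : ℝ → ℝ) (B : Set ℝ) : Measure ℝ :=
  (volume.restrict B).map x

/-- `L t` is a density of the occupation measure of the path `x` over `[0, t]`, for
every `t ≥ 0`. -/
def IsLocalTime (x : ℝ → ℝ) (L : ℝ → ℝ → ℝ) : Prop :=
  ∀ t : ℝ, 0 ≤ t → Measurable (L t) ∧ (∀ y, 0 ≤ L t y) ∧
    occupationMeasure x (Icc 0 t) = volume.withDensity (fun y => ENNReal.ofReal (L t y))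

/-- The process `⟨·, M 1_{[0,t)}⟩` has a jointly measurable version, and almost every path of
every such version has a local time which is continuous in `t` for almost every level `y` and
square integrable in `y`. -/
def HasContinuousL2LocalTime (μ : Measure SchwartzDual) (M : (ℝ → ℝ) → ℝ → ℝ) : Prop :=
  (∃ X, IsBGProcess μ M X) ∧
  ∀ X, IsBGProcess μ M X → ∀ᵐ u ∂μ, ∃ L : ℝ → ℝ → ℝ,
    IsLocalTime (fun s => X s u) L ∧
    (∀ᵐ y, ContinuousOn (fun t => L t y) (Ici 0)) ∧
    ∀ t : ℝ, 0 ≤ t → MemLp (L t) 2 volume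

end BGM

end

/-! The local time exists because occupation measures have small expected energy. Let `ρ` be the
occupation measure of a path over an interval `I`. The squared `L²` norm of the mean density of `ρ`
on balls of radius `r` is at most `(ρ ⊗ ρ){|a - b| ≤ 2r} / (2r)`. In expectation this is the
integral of `P(|X_s - X_t| ≤ 2r) / (2r)` over `I × I`. The increment `X_s - X_t` is a centred
Gaussian whose variance is at least a multiple of `|s - t|^(1-β)`, so the expectation is bounded,
uniformly in `r`, by a multiple of the integral of `|s - t|^(-γ)` over `I × I`, with `γ = (1-β)/2 <
1`. Fatou's lemma as `r → 0` gives a square integrable density almost surely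
(`ae_exists_continuous_localTime`).

Continuity in time comes from the absence of atoms, not from moment estimates. A disintegration
(`exists_occupation_kernel`) provides, at each level `y`, a measure in time whose mass on `B` is the
density at `y` of the occupation measure over `B`. An atom of this measure would contribute a fixed
amount to the sum of squared densities over the cells of every partition of `[0, N]`. The
expectation of the integral of that sum over `y`, for mesh `h`, is at most a constant times the
integral of `|w|^(-γ)` over `|w| ≤ h`, which tends to `0` (`exists_continuous_localTime`).

The variance bound is spectral. Both operators send the indicator of `[0, t)` to a multiple of `k(t
- x) - k(-x)`, with `k = ν` in the derivative case and `k = χ` in the integral case. The Laplace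
transform of `k` is `φ(z)/z`, respectively `1/(z φ(z))`, and wherever `A_φ(ξ) ≠ 0` with `ξ ≠ 0` its
boundary value at `iξ` has squared modulus `A_φ(ξ)/ξ²`. Exponential damping, Plancherel and Fatou
show that the squared norm of the increment is at least `(1/π) ∫ (1 - cos tξ) A_φ(ξ)/ξ² dξ`. Scaling
by `t` turns this into the hypothesis with `a = 1/t` (`IsL2Kernel.le_integral_sq_kernelIncrement`).
Only this inequality is needed, never the exact spectral formula. -/

namespace BGM

open ProbabilityTheory ENNReal NNReal

/-! ### White noise: Gaussian laws and the pairing with `L²` functions. -/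

section WhiteNoise

theorem eLpNorm_two_eq_ofReal_sqrt {α : Type*} [MeasurableSpace α] {ρ : Measure α} {f : α → ℝ}
    (hf : MemLp f 2 ρ) : eLpNorm f 2 ρ = ENNReal.ofReal √(∫ x, f x ^ 2 ∂ρ) := by
  rw [hf.eLpNorm_eq_integral_rpow_norm (by norm_num) (by norm_num), Real.sqrt_eq_rpow]
  simp

theorem measurable_apply_schwartzDual (ξ : 𝓢(ℝ, ℝ)) :
    Measurable (fun u : SchwartzDual => u ξ) := by
  rw [measurable_iff_comap_le, BorelSpace.measurable_eq (α := ℝ)]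
  exact le_iSup (fun ξ : 𝓢(ℝ, ℝ) =>
    MeasurableSpace.comap (fun u : SchwartzDual => u ξ) (borel ℝ)) ξ

variable {μ : Measure SchwartzDual}

/-- The characteristic functional at `t • ξ`, read as a function of `t`, is the characteristic
function of the law of `u ξ`. -/
theorem IsWhiteNoise.map_apply (hμ : IsWhiteNoise μ) (ξ : 𝓢(ℝ, ℝ)) :
    μ.map (fun u => u ξ) = gaussianReal 0 (∫ x, ξ x ^ 2).toNNReal := by
  have := hμ.isProbabilityMeasure
  have := Measure.isProbabilityMeasure_map (μ := μ) (measurable_apply_schwartzDual ξ).aemeasurable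
  refine Measure.ext_of_charFun (funext fun t => ?_)
  rw [charFun_gaussianReal, charFun_apply_real,
    integral_map (measurable_apply_schwartzDual ξ).aemeasurable (by fun_prop)]
  have h := hμ.charFunctional (t • ξ)
  have e : ∫ x, (t • ξ) x ^ 2 = t ^ 2 * ∫ x, ξ x ^ 2 := by
    rw [← integral_const_mul]
    congr 1
    ext x
    simp [mul_pow]
  have p : (0:ℝ) ≤ ∫ x, ξ x ^ 2 := integral_nonneg fun x => sq_nonneg _
  rw [e] at h
  convert h using 2
  · ext u
    simp
    ring_nf
  · have : (((∫ x, ξ x ^ 2).toNNReal : ℝ) : ℂ) = ((∫ x, ξ x ^ 2 : ℝ) : ℂ) := by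
      rw [Real.coe_toNNReal _ p]
    rw [this]
    push_cast
    ring

theorem memLp_of_map_gaussian {Z : SchwartzDual → ℝ} {v : ℝ≥0}
    (hZ : AEMeasurable Z μ) (h : μ.map Z = gaussianReal 0 v) : MemLp Z 2 μ := by
  have := memLp_id_gaussianReal' (μ := 0) (v := v) 2 (by norm_num)
  rw [← h] at this
  exact (memLp_map_measure_iff this.1 hZ).1 this

theorem eLpNorm_of_map_gaussian {Z : SchwartzDual → ℝ} {v : ℝ≥0}
    (hZ : AEMeasurable Z μ) (h : μ.map Z = gaussianReal 0 v) :
    eLpNorm Z 2 μ = ENNReal.ofReal √v := by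
  rw [eLpNorm_two_eq_ofReal_sqrt (memLp_of_map_gaussian hZ h)]
  congr 2
  have h1 : ∫ u, Z u ^ 2 ∂μ = ∫ x, x ^ 2 ∂(μ.map Z) :=
    (integral_map hZ (f := fun x : ℝ => x ^ 2) (by fun_prop)).symm
  rw [h1, h]
  have h2 := variance_id_gaussianReal (μ := 0) (v := v)
  rw [variance_eq_integral aemeasurable_id] at h2
  simpa [integral_id_gaussianReal] using h2

theorem IsWhiteNoise.memLp_apply (hμ : IsWhiteNoise μ) (ξ : 𝓢(ℝ, ℝ)) :
    MemLp (fun u : SchwartzDual => u ξ) 2 μ :=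
  memLp_of_map_gaussian (measurable_apply_schwartzDual ξ).aemeasurable (hμ.map_apply ξ)

theorem IsWhiteNoise.eLpNorm_apply (hμ : IsWhiteNoise μ) (ξ : 𝓢(ℝ, ℝ)) :
    eLpNorm (fun u : SchwartzDual => u ξ) 2 μ = eLpNorm ξ 2 volume := by
  rw [eLpNorm_of_map_gaussian (measurable_apply_schwartzDual ξ).aemeasurable (hμ.map_apply ξ),
    eLpNorm_two_eq_ofReal_sqrt (ξ.memLp 2 volume),
    Real.coe_toNNReal _ (integral_nonneg fun x => sq_nonneg _)]

theorem IsWhiteNoise.eLpNorm_sub (hμ : IsWhiteNoise μ) (ξ η : 𝓢(ℝ, ℝ)) :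
    eLpNorm (fun u : SchwartzDual => u ξ - u η) 2 μ = eLpNorm (fun x => ξ x - η x) 2 volume := by
  have := hμ.eLpNorm_apply (ξ - η)
  simpa only [map_sub] using! this

theorem exists_schwartz_seq {f : ℝ → ℝ} (hf : MemLp f 2 volume) :
    ∃ ξ : ℕ → 𝓢(ℝ, ℝ), Tendsto (fun n => eLpNorm (fun x => ξ n x - f x) 2 volume) atTop (𝓝 0) := by
  have hd := SchwartzMap.denseRange_toLpCLM (E := ℝ) (F := ℝ) (μ := volume)
    (p := 2) (by norm_num)
  obtain ⟨s, hs, hlim⟩ := mem_closure_iff_seq_limit.1 (hd (hf.toLp f))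
  choose ξ hξ using hs
  refine ⟨ξ, ?_⟩
  rw [Lp.tendsto_Lp_iff_tendsto_eLpNorm'] at hlim
  refine hlim.congr fun n => eLpNorm_congr_ae ?_
  rw [← hξ n]
  filter_upwards [hf.coeFn_toLp, (ξ n).coeFn_toLp 2 volume] with x h1 h2
  simp only [Pi.sub_apply, h1]
  exact congrArg (· - f x) h2

/-- On Schwartz functions the pairing is an isometry into `L²(μ)`, so it carries a sequence
converging to `f` to a Cauchy sequence. Any other sequence converging to `f` has the same limit,
again by the isometry. -/
theorem IsWhiteNoise.exists_isPairing (hμ : IsWhiteNoise μ) {f : ℝ → ℝ} (hf : MemLp f 2 volume) :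
    ∃ Y : SchwartzDual → ℝ, Measurable Y ∧ IsPairing μ f Y := by
  have := hμ.isProbabilityMeasure
  obtain ⟨ξ, hξ⟩ := exists_schwartz_seq hf
  have hc : CauchySeq fun n => (hμ.memLp_apply (ξ n)).toLp _ := by
    rw [EMetric.cauchySeq_iff]
    intro ε hε
    obtain ⟨N, hN⟩ := eventually_atTop.1 (hξ.eventually_lt_const (ENNReal.half_pos hε.ne'))
    refine ⟨N, fun m hm n hn => ?_⟩
    rw [Lp.edist_toLp_toLp]
    have h1 : eLpNorm (fun x => ξ m x - ξ n x) 2 volume ≤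
        eLpNorm (fun x => ξ m x - f x) 2 volume + eLpNorm (fun x => ξ n x - f x) 2 volume := by
      have := eLpNorm_sub_le (μ := volume) (p := 2)
        (((ξ m).memLp 2 volume).sub hf).1 (((ξ n).memLp 2 volume).sub hf).1 (by norm_num)
      refine le_trans (le_of_eq ?_) this
      congr 1
      ext x
      simp
    calc _ = eLpNorm (fun x => ξ m x - ξ n x) 2 volume := hμ.eLpNorm_sub _ _
      _ < ε / 2 + ε / 2 := h1.trans_lt (ENNReal.add_lt_add (hN m hm) (hN n hn))
      _ = ε := ENNReal.add_halves ε
  obtain ⟨Y, hY⟩ := cauchySeq_tendsto_of_complete hc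
  obtain ⟨Z, hZm, hZae⟩ : ∃ Z : SchwartzDual → ℝ, Measurable Z ∧ Y =ᵐ[μ] Z :=
    ⟨_, (Lp.memLp Y).1.stronglyMeasurable_mk.measurable, (Lp.memLp Y).1.ae_eq_mk⟩
  have hZ : MemLp Z 2 μ := (memLp_congr_ae hZae).1 (Lp.memLp Y)
  refine ⟨Z, hZm, hf, hZ, fun η hη => ?_⟩
  have h1 : Tendsto (fun n => eLpNorm (fun u : SchwartzDual => u (ξ n) - Z u) 2 μ) atTop (𝓝 0) := by
    rw [Lp.tendsto_Lp_iff_tendsto_eLpNorm'] at hY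
    refine hY.congr fun n => eLpNorm_congr_ae ?_
    filter_upwards [(hμ.memLp_apply (ξ n)).coeFn_toLp, hZae] with u hu hu'
    simp [hu, hu']
  have h2 := (hη.add hξ).add h1
  simp only [add_zero] at h2
  refine tendsto_of_tendsto_of_tendsto_of_le_of_le tendsto_const_nhds h2 (fun _ => zero_le) fun n => ?_
  calc eLpNorm (fun u : SchwartzDual => u (η n) - Z u) 2 μ
      = eLpNorm ((fun u : SchwartzDual => u (η n) - u (ξ n)) +
          fun u : SchwartzDual => u (ξ n) - Z u) 2 μ := by
        congr 1
        ext u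
        simp
    _ ≤ eLpNorm (fun u : SchwartzDual => u (η n) - u (ξ n)) 2 μ +
        eLpNorm (fun u : SchwartzDual => u (ξ n) - Z u) 2 μ :=
        eLpNorm_add_le ((hμ.memLp_apply _).sub (hμ.memLp_apply _)).1
          ((hμ.memLp_apply _).sub hZ).1 (by norm_num)
    _ ≤ _ := by
        gcongr
        rw [hμ.eLpNorm_sub]
        have := eLpNorm_sub_le (μ := volume) (p := 2)
          (((η n).memLp 2 volume).sub hf).1 (((ξ n).memLp 2 volume).sub hf).1 (by norm_num)
        refine le_trans (le_of_eq ?_) this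
        congr 1
        ext x
        simp

theorem IsPairing.congr_left {f g : ℝ → ℝ} {Y : SchwartzDual → ℝ} (h : IsPairing μ f Y)
    (hfg : f =ᵐ[volume] g) : IsPairing μ g Y := by
  refine ⟨(memLp_congr_ae hfg).1 h.memLp, h.memLp_pairing, fun ξ hξ => h.tendsto ξ ?_⟩
  refine hξ.congr fun n => eLpNorm_congr_ae ?_
  filter_upwards [hfg] with x hx
  rw [hx]

theorem IsPairing.congr_right {f : ℝ → ℝ} {Y Z : SchwartzDual → ℝ} (h : IsPairing μ f Y)
    (hYZ : Y =ᵐ[μ] Z) : IsPairing μ f Z := by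
  refine ⟨h.memLp, (memLp_congr_ae hYZ).1 h.memLp_pairing, fun ξ hξ => ?_⟩
  refine (h.tendsto ξ hξ).congr fun n => eLpNorm_congr_ae ?_
  filter_upwards [hYZ] with x hx
  rw [hx]

theorem tendsto_eLpNorm_of_sub {α : Type*} [MeasurableSpace α] {ρ : Measure α}
    {F : ℕ → α → ℝ} {G : α → ℝ} (hF : ∀ n, MemLp (F n) 2 ρ) (hG : MemLp G 2 ρ)
    (h : Tendsto (fun n => eLpNorm (fun x => F n x - G x) 2 ρ) atTop (𝓝 0)) :
    Tendsto (fun n => ∫ x, F n x ^ 2 ∂ρ) atTop (𝓝 (∫ x, G x ^ 2 ∂ρ)) := by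
  have h1 : Tendsto (fun n => (hF n).toLp (F n)) atTop (𝓝 (hG.toLp G)) := by
    rw [Lp.tendsto_Lp_iff_tendsto_eLpNorm']
    refine h.congr fun n => eLpNorm_congr_ae ?_
    filter_upwards [(hF n).coeFn_toLp, hG.coeFn_toLp] with x h1 h2
    simp [h1, h2]
  have key : ∀ {f : α → ℝ} (hf : MemLp f 2 ρ), ‖hf.toLp f‖ ^ 2 = ∫ x, f x ^ 2 ∂ρ := by
    intro f hf
    rw [Lp.norm_toLp, eLpNorm_two_eq_ofReal_sqrt hf, ENNReal.toReal_ofReal (Real.sqrt_nonneg _),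
      Real.sq_sqrt (integral_nonneg fun x => sq_nonneg _)]
  simpa only [key] using (h1.norm).pow 2

/-- Gaussian laws survive `L²` limits: the differences `ξ n - η n` of approximants converge to `f -
g`, their variances converge, and so do their characteristic functions. Working with differences
from the start avoids proving linearity of the extended pairing. -/
theorem IsWhiteNoise.map_sub (hμ : IsWhiteNoise μ) {f g : ℝ → ℝ} {Y Z : SchwartzDual → ℝ}
    (hY : IsPairing μ f Y) (hZ : IsPairing μ g Z) :
    μ.map (fun u => Y u - Z u) = gaussianReal 0 (∫ x, (f x - g x) ^ 2).toNNReal := by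
  have := hμ.isProbabilityMeasure
  obtain ⟨ξ, hξ⟩ := exists_schwartz_seq hY.memLp
  obtain ⟨η, hη⟩ := exists_schwartz_seq hZ.memLp
  have hD : MemLp (fun u => Y u - Z u) 2 μ := hY.memLp_pairing.sub hZ.memLp_pairing
  have hDm := hD.1.aemeasurable
  have := Measure.isProbabilityMeasure_map (μ := μ) hDm
  have h1 : Tendsto (fun n => ∫ x, (ξ n - η n) x ^ 2) atTop (𝓝 (∫ x, (f x - g x) ^ 2)) := by
    refine tendsto_eLpNorm_of_sub (fun n => (ξ n - η n).memLp 2 volume)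
      (hY.memLp.sub hZ.memLp) ?_
    have h2 := hξ.add hη
    simp only [add_zero] at h2
    refine tendsto_of_tendsto_of_tendsto_of_le_of_le tendsto_const_nhds h2
      (fun _ => zero_le) fun n => ?_
    have := eLpNorm_sub_le (μ := volume) (p := 2)
        (((ξ n).memLp 2 volume).sub hY.memLp).1 (((η n).memLp 2 volume).sub hZ.memLp).1
        (by norm_num)
    refine le_trans (le_of_eq ?_) this
    congr 1
    ext x
    simp
    ring
  have h2 : Tendsto (fun n => eLpNorm (fun u : SchwartzDual => u (ξ n - η n) - (Y u - Z u)) 2 μ)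
      atTop (𝓝 0) := by
    have h2 := (hY.tendsto ξ hξ).add (hZ.tendsto η hη)
    simp only [add_zero] at h2
    refine tendsto_of_tendsto_of_tendsto_of_le_of_le tendsto_const_nhds h2
      (fun _ => zero_le) fun n => ?_
    have := eLpNorm_sub_le (μ := μ) (p := 2)
        ((hμ.memLp_apply (ξ n)).sub hY.memLp_pairing).1
        ((hμ.memLp_apply (η n)).sub hZ.memLp_pairing).1 (by norm_num)
    refine le_trans (le_of_eq ?_) this
    congr 1
    ext x
    simp
    ring
  have h3 : TendstoInMeasure μ (fun n (u : SchwartzDual) => u (ξ n - η n)) atTop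
      (fun u => Y u - Z u) :=
    tendstoInMeasure_of_tendsto_eLpNorm (by norm_num) (fun n => (hμ.memLp_apply _).1) hD.1 h2
  -- Almost everywhere convergence along a subsequence suffices for dominated convergence of the
  -- characteristic functions, whose integrands have modulus one.
  obtain ⟨ns, hns, hae⟩ := h3.exists_seq_tendsto_ae
  refine Measure.ext_of_charFun (funext fun t => ?_)
  have h4 : Tendsto (fun n => charFun (μ.map (fun u : SchwartzDual => u (ξ (ns n) - η (ns n)))) t)
      atTop (𝓝 (charFun (μ.map (fun u => Y u - Z u)) t)) := by
    simp only [charFun_apply_real]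
    have e : ∀ n, ∫ x : ℝ, Complex.exp (t * x * Complex.I)
        ∂(μ.map (fun u : SchwartzDual => u (ξ (ns n) - η (ns n)))) =
        ∫ u, Complex.exp (t * (u (ξ (ns n) - η (ns n)) : ℝ) * Complex.I) ∂μ := fun n =>
      integral_map (measurable_apply_schwartzDual _).aemeasurable (by fun_prop)
    simp only [e]
    rw [integral_map hDm (by fun_prop)]
    refine tendsto_integral_of_dominated_convergence (fun _ => 1) (fun n => ?_)
      (integrable_const _) (fun n => ?_) ?_
    · have := measurable_apply_schwartzDual (ξ (ns n) - η (ns n))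
      exact (Complex.measurable_exp.comp ((measurable_const.mul
        (Complex.measurable_ofReal.comp this)).mul_const _)).aestronglyMeasurable
    · refine Eventually.of_forall fun u => ?_
      have := Complex.norm_exp_ofReal_mul_I (t * u (ξ (ns n) - η (ns n)))
      push_cast at this ⊢
      exact this.le
    · filter_upwards [hae] with u hu
      have hcont : Continuous fun x : ℝ => Complex.exp (t * x * Complex.I) := by fun_prop
      exact (hcont.tendsto _).comp hu
  refine tendsto_nhds_unique h4 ?_
  simp only [hμ.map_apply, charFun_gaussianReal]
  have h5 := (h1.comp hns.tendsto_atTop)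
  have h6 : Tendsto (fun n => (((∫ x, (ξ (ns n) - η (ns n)) x ^ 2).toNNReal : ℝ≥0) : ℝ)) atTop
      (𝓝 ((∫ x, (f x - g x) ^ 2).toNNReal : ℝ)) :=
    ((NNReal.continuous_coe.comp continuous_real_toNNReal).tendsto _).comp h5
  have hcont : Continuous fun v : ℝ =>
      Complex.exp (t * (0:ℝ) * Complex.I - (v : ℂ) * t ^ 2 / 2) := by fun_prop
  exact (hcont.tendsto _).comp h6

theorem IsWhiteNoise.eLpNorm_pairing_sub (hμ : IsWhiteNoise μ) {f g : ℝ → ℝ}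
    {Y Z : SchwartzDual → ℝ} (hY : IsPairing μ f Y) (hZ : IsPairing μ g Z) :
    eLpNorm (fun u => Y u - Z u) 2 μ = eLpNorm (fun x => f x - g x) 2 volume := by
  have hD : MemLp (fun u => Y u - Z u) 2 μ := hY.memLp_pairing.sub hZ.memLp_pairing
  have hd : MemLp (fun x => f x - g x) 2 volume := hY.memLp.sub hZ.memLp
  rw [eLpNorm_of_map_gaussian hD.1.aemeasurable (hμ.map_sub hY hZ), eLpNorm_two_eq_ofReal_sqrt hd,
    Real.coe_toNNReal _ (integral_nonneg fun x => sq_nonneg _)]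

/-- The Gaussian density is at most `1 / √(2πv) ≤ 1 / √v`, and the ball has length `2δ`. -/
theorem gaussianReal_closedBall_le {v : ℝ≥0} (hv : v ≠ 0) (δ : ℝ) :
    gaussianReal 0 v (Metric.closedBall 0 δ) ≤ ENNReal.ofReal (2 * δ / √v) := by
  have hv' : 0 < √(v : ℝ) := Real.sqrt_pos.2 (by positivity)
  rw [gaussianReal_apply 0 hv]
  calc ∫⁻ x in Metric.closedBall 0 δ, gaussianPDF 0 v x
      ≤ ∫⁻ x in Metric.closedBall (0 : ℝ) δ, ENNReal.ofReal (1 / √v) := by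
        refine lintegral_mono fun x => ENNReal.ofReal_le_ofReal ?_
        rw [gaussianPDFReal, ← one_div]
        have h1 : Real.exp (-(x - 0) ^ 2 / (2 * v)) ≤ 1 := by
          refine Real.exp_le_one_iff.2 (div_nonpos_of_nonpos_of_nonneg ?_ (by positivity))
          nlinarith [sq_nonneg (x - 0)]
        have h2 : √(v : ℝ) ≤ √(2 * Real.pi * v) := by
          refine Real.sqrt_le_sqrt ?_
          nlinarith [Real.pi_gt_three, v.2]
        calc _ ≤ 1 / √(2 * Real.pi * v) * 1 := by gcongr
          _ ≤ _ := by rw [mul_one]; gcongr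
    _ = _ := by
        rw [setLIntegral_const, Real.volume_closedBall, ← ENNReal.ofReal_mul (by positivity)]
        congr 1
        ring

theorem IsWhiteNoise.measure_abs_sub_le (hμ : IsWhiteNoise μ) {f g : ℝ → ℝ}
    {Y Z : SchwartzDual → ℝ} (hY : IsPairing μ f Y) (hZ : IsPairing μ g Z)
    (h : 0 < ∫ x, (f x - g x) ^ 2) (δ : ℝ) :
    μ {u | |Y u - Z u| ≤ δ} ≤ ENNReal.ofReal (2 * δ / √(∫ x, (f x - g x) ^ 2)) := by
  have hD : MemLp (fun u => Y u - Z u) 2 μ := hY.memLp_pairing.sub hZ.memLp_pairing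
  have h1 := gaussianReal_closedBall_le (v := (∫ x, (f x - g x) ^ 2).toNNReal)
    (by simpa using h) δ
  rw [← hμ.map_sub hY hZ, Measure.map_apply_of_aemeasurable
    hD.1.aemeasurable Metric.isClosed_closedBall.measurableSet,
    Real.coe_toNNReal _ h.le] at h1
  convert h1 using 3
  ext u
  simp

end WhiteNoise

/-! ### Jointly measurable versions. -/

theorem ae_tendsto_of_eLpNorm_le {Ω : Type*} [MeasurableSpace Ω] {P : Measure Ω}
    [IsProbabilityMeasure P] {F : ℕ → Ω → ℝ} {G : Ω → ℝ}
    (hF : ∀ k, AEStronglyMeasurable (F k) P) (hG : AEStronglyMeasurable G P)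
    (h : ∀ k, eLpNorm (fun u => F k u - G u) 2 P ≤ 2⁻¹ ^ k) :
    ∀ᵐ u ∂P, Tendsto (fun k => F k u) atTop (𝓝 (G u)) := by
  have hm : ∀ k, AEStronglyMeasurable (fun u => F k u - G u) P := fun k => (hF k).sub hG
  have h1 : ∀ k, ∫⁻ u, ‖F k u - G u‖ₑ ∂P ≤ 2⁻¹ ^ k := fun k => by
    rw [← eLpNorm_one_eq_lintegral_enorm]
    exact (eLpNorm_le_eLpNorm_of_exponent_le (by norm_num) (hm k)).trans (h k)
  have h2 : ∫⁻ u, ∑' k, ‖F k u - G u‖ₑ ∂P ≠ ⊤ := by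
    rw [lintegral_tsum fun k => (hm k).enorm]
    refine ((ENNReal.tsum_le_tsum h1).trans_lt ?_).ne
    rw [ENNReal.tsum_geometric, ENNReal.one_sub_inv_two, inv_inv]
    exact ENNReal.ofNat_lt_top
  filter_upwards [ae_lt_top' (AEMeasurable.tsum fun k => (hm k).enorm) h2] with u hu
  have h3 := ENNReal.tendsto_atTop_zero_of_tsum_ne_top hu.ne
  rw [tendsto_iff_edist_tendsto_0]
  simpa only [edist_eq_enorm_sub] using h3

/-- Uniform `L²` continuity in time allows `X t` to be approximated by values on a grid. Step
processes in time are jointly measurable, and a mesh with error `2⁻¹ ^ k` makes them converge almost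
surely at each fixed `t`. -/
theorem IsWhiteNoise.exists_measurable_version {μ : Measure SchwartzDual} (hμ : IsWhiteNoise μ)
    {m : ℝ → ℝ → ℝ} (hm : ∀ t, 0 ≤ t → MemLp (m t) 2 volume)
    (hmod : ∀ ε : ℝ≥0∞, 0 < ε → ∃ δ : ℝ, 0 < δ ∧ ∀ s t, 0 ≤ s → s ≤ t → t - s ≤ δ →
      eLpNorm (fun x => m s x - m t x) 2 volume ≤ ε) :
    ∃ X : ℝ → SchwartzDual → ℝ, Measurable (Function.uncurry X) ∧
      ∀ t, 0 ≤ t → IsPairing μ (m t) (X t) := by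
  have := hμ.isProbabilityMeasure
  have hY : ∀ t, ∃ Y : SchwartzDual → ℝ, Measurable Y ∧ (0 ≤ t → IsPairing μ (m t) Y) := by
    intro t
    by_cases ht : 0 ≤ t
    · obtain ⟨Y, h1, h2⟩ := hμ.exists_isPairing (hm t ht)
      exact ⟨Y, h1, fun _ => h2⟩
    · exact ⟨0, measurable_zero, fun h => (ht h).elim⟩
  choose Y hYm hYp using hY
  have hδ : ∀ k : ℕ, ∃ δ : ℝ, 0 < δ ∧ ∀ s t, 0 ≤ s → s ≤ t → t - s ≤ δ →
      eLpNorm (fun x => m s x - m t x) 2 volume ≤ 2⁻¹ ^ k := fun k =>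
    hmod _ (ENNReal.pow_pos (by simp) k)
  choose δ hδ0 hδ using hδ
  set Z : ℕ → ℝ → SchwartzDual → ℝ := fun k t u => Y (δ k * ⌊t / δ k⌋₊) u with hZ
  have hZm : ∀ k, Measurable (Function.uncurry (Z k)) := by
    intro k
    have h1 : Measurable fun p : ℕ × SchwartzDual => Y (δ k * p.1) p.2 :=
      measurable_from_prod_countable_right fun n => hYm (δ k * n)
    have h2 : Measurable fun p : ℝ × SchwartzDual => (⌊p.1 / δ k⌋₊, p.2) :=
      (Nat.measurable_floor.comp (measurable_fst.div_const _)).prodMk measurable_snd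
    exact h1.comp h2
  -- The `limsup` is jointly measurable whether or not the approximations converge; its value at
  -- points of divergence is irrelevant.
  refine ⟨fun t u => limsup (fun k => Z k t u) atTop, ?_, fun t ht => ?_⟩
  · exact Measurable.limsup hZm
  · refine (hYp t ht).congr_right ?_
    have h1 : ∀ k, 0 ≤ δ k * ⌊t / δ k⌋₊ := fun k => mul_nonneg (hδ0 k).le (Nat.cast_nonneg _)
    have h2 : ∀ k, δ k * ⌊t / δ k⌋₊ ≤ t := fun k => by
      have := Nat.floor_le (div_nonneg ht (hδ0 k).le)
      rwa [le_div_iff₀' (hδ0 k)] at this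
    have h3 : ∀ k, t - δ k * ⌊t / δ k⌋₊ ≤ δ k := fun k => by
      have := (Nat.lt_floor_add_one (t / δ k)).le
      rw [div_le_iff₀' (hδ0 k)] at this
      linarith
    have := ae_tendsto_of_eLpNorm_le (P := μ) (F := fun k => Z k t) (G := Y t)
      (fun k => (hYm _).aestronglyMeasurable) (hYm t).aestronglyMeasurable fun k => by
        rw [hμ.eLpNorm_pairing_sub (hYp _ (h1 k)) (hYp t ht)]
        exact hδ k _ _ (h1 k) (h2 k) (h3 k)
    filter_upwards [this] with u hu
    exact hu.limsup_eq.symm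

/-! ### Measures with square integrable density -/

/-- The squared `L²` norm of the mean density of `ρ` on closed balls of radius `r`. -/
noncomputable def ballEnergy (ρ : Measure ℝ) (r : ℝ) : ℝ≥0∞ :=
  ∫⁻ y, (ρ (Metric.closedBall y r) / volume (Metric.closedBall y r)) ^ 2

/-- The lower limit of `ballEnergy` along the radii `1 / (n + 1)`. -/
noncomputable def lowerEnergy (ρ : Measure ℝ) : ℝ≥0∞ :=
  liminf (fun n : ℕ => ballEnergy ρ (1 / ((n : ℝ) + 1))) atTop

theorem measurable_measure_closedBall (ρ : Measure ℝ) [SFinite ρ] (r : ℝ) :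
    Measurable fun y => ρ (Metric.closedBall y r) := by
  have hs : MeasurableSet {p : ℝ × ℝ | dist p.2 p.1 ≤ r} :=
    measurableSet_le (by fun_prop) measurable_const
  exact measurable_measure_prodMk_left hs

theorem measurable_volume_inter_closedBall {U : Set ℝ} (hU : MeasurableSet U) (r : ℝ) :
    Measurable fun x => volume (U ∩ Metric.closedBall x r) := by
  have hs : MeasurableSet {p : ℝ × ℝ | dist p.2 p.1 ≤ r} :=
    measurableSet_le (by fun_prop) measurable_const
  exact measurable_measure_prodMk_left (ν := volume) ((measurable_snd hU).inter hs)

/-- Mean densities on shrinking balls converge almost everywhere to the Radon–Nikodym derivative, so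
Fatou applies. Alone this says nothing about a singular part of `ρ`. -/
theorem lintegral_rnDeriv_sq_le (ρ : Measure ℝ) [IsFiniteMeasure ρ] :
    ∫⁻ y, ρ.rnDeriv volume y ^ 2 ≤ lowerEnergy ρ := by
  have hr : Tendsto (fun n : ℕ => 1 / ((n : ℝ) + 1)) atTop (𝓝[>] 0) :=
    tendsto_nhdsWithin_iff.2 ⟨tendsto_one_div_add_atTop_nhds_zero_nat,
      Eventually.of_forall fun n => mem_Ioi.2 (by positivity)⟩
  calc ∫⁻ y, ρ.rnDeriv volume y ^ 2
      = ∫⁻ y, liminf (fun n : ℕ => (ρ (Metric.closedBall y (1 / ((n : ℝ) + 1))) /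
          volume (Metric.closedBall y (1 / ((n : ℝ) + 1)))) ^ 2) atTop := by
        refine lintegral_congr_ae ?_
        filter_upwards [Besicovitch.ae_tendsto_rnDeriv ρ volume] with y hy
        exact (((ENNReal.continuous_pow 2).tendsto _).comp (hy.comp hr)).liminf_eq.symm
    _ ≤ _ := lintegral_liminf_le fun n =>
        ((measurable_measure_closedBall ρ _).div (measurable_measure_closedBall volume _)).pow_const 2

theorem lintegral_volume_inter_closedBall (ρ : Measure ℝ) [SFinite ρ] {U : Set ℝ}
    (hU : MeasurableSet U) {r : ℝ} :
    ∫⁻ x, volume (U ∩ Metric.closedBall x r) / volume (Metric.closedBall x r) ∂ρ =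
      ∫⁻ y in U, ρ (Metric.closedBall y r) / volume (Metric.closedBall y r) := by
  simp only [Real.volume_closedBall, div_eq_mul_inv]
  have hs : MeasurableSet {p : ℝ × ℝ | dist p.2 p.1 ≤ r} :=
    measurableSet_le (by fun_prop) measurable_const
  rw [lintegral_mul_const _ (measurable_volume_inter_closedBall hU r),
    lintegral_mul_const _ (measurable_measure_closedBall ρ r)]
  congr 1
  calc ∫⁻ x, volume (U ∩ Metric.closedBall x r) ∂ρ
      = ∫⁻ x, (∫⁻ y in U,
          {p : ℝ × ℝ | dist p.2 p.1 ≤ r}.indicator (fun _ => (1 : ℝ≥0∞)) (x, y)) ∂ρ := by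
        refine lintegral_congr fun x => ?_
        rw [inter_comm, ← Measure.restrict_apply Metric.isClosed_closedBall.measurableSet,
          ← lintegral_indicator_one Metric.isClosed_closedBall.measurableSet]
        rfl
    _ = ∫⁻ y in U, ∫⁻ x, {p : ℝ × ℝ | dist p.2 p.1 ≤ r}.indicator (fun _ => (1 : ℝ≥0∞)) (x, y) ∂ρ :=
        lintegral_lintegral_swap (f := fun x y =>
          {p : ℝ × ℝ | dist p.2 p.1 ≤ r}.indicator (fun _ => (1 : ℝ≥0∞)) (x, y))
          (measurable_const.indicator hs).aemeasurable
    _ = _ := by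
        refine lintegral_congr fun y => ?_
        rw [← lintegral_indicator_one Metric.isClosed_closedBall.measurableSet]
        refine lintegral_congr fun x => ?_
        simp only [indicator, mem_ofPred_eq, Metric.mem_closedBall, dist_comm y x, Pi.one_apply]

/-- At each point of `U` small balls lie inside `U`, so the fraction of the ball covered by `U` is
eventually `1`. Fatou under `ρ`, Tonelli and Cauchy–Schwarz on `U` bring in the energy. This is the
estimate that rules out a singular part. -/
theorem measure_le_of_isOpen (ρ : Measure ℝ) [IsFiniteMeasure ρ] {M : ℝ≥0∞}
    (hM : lowerEnergy ρ < M) {U : Set ℝ} (hU : IsOpen U) :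
    ρ U ≤ M ^ (1 / 2 : ℝ) * volume U ^ (1 / 2 : ℝ) := by
  have hb : ∀ x (n : ℕ), volume (Metric.closedBall x (1 / ((n : ℝ) + 1))) ≠ 0 := fun x n => by
    rw [Real.volume_closedBall]
    simp only [ne_eq, ENNReal.ofReal_eq_zero, not_le]
    positivity
  have hb' : ∀ x (n : ℕ), volume (Metric.closedBall x (1 / ((n : ℝ) + 1))) ≠ ⊤ := fun x n => by
    rw [Real.volume_closedBall]
    exact ENNReal.ofReal_ne_top
  have h1 : ρ U ≤ ∫⁻ x, liminf (fun n : ℕ => volume (U ∩ Metric.closedBall x (1 / ((n : ℝ) + 1))) /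
      volume (Metric.closedBall x (1 / ((n : ℝ) + 1)))) atTop ∂ρ := by
    rw [← lintegral_indicator_one hU.measurableSet]
    refine lintegral_mono fun x => ?_
    by_cases hx : x ∈ U
    · rw [indicator_of_mem hx, Pi.one_apply]
      obtain ⟨ε, hε, hball⟩ := Metric.isOpen_iff.1 hU x hx
      refine le_liminf_of_le (by isBoundedDefault) ?_
      filter_upwards [tendsto_one_div_add_atTop_nhds_zero_nat.eventually_lt_const hε] with n hn
      rw [inter_eq_right.2 ((Metric.closedBall_subset_ball hn).trans hball),
        ENNReal.div_self (hb x n) (hb' x n)]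
    · simp [indicator_of_notMem hx]
  have h2 : ρ U ≤ liminf (fun n : ℕ => ∫⁻ y in U, ρ (Metric.closedBall y (1 / ((n : ℝ) + 1))) /
      volume (Metric.closedBall y (1 / ((n : ℝ) + 1)))) atTop := by
    refine h1.trans ((lintegral_liminf_le fun n => ?_).trans (le_of_eq ?_))
    · exact (measurable_volume_inter_closedBall hU.measurableSet _).div
        (measurable_measure_closedBall volume _)
    · simp only [lintegral_volume_inter_closedBall ρ hU.measurableSet]
  refine h2.trans (liminf_le_of_frequently_le' ?_)
  -- The energy is below `M` only along infinitely many radii, which is enough to bound a lower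
  -- limit.
  refine (frequently_lt_of_liminf_lt (by isBoundedDefault) hM).mono fun n hn => ?_
  calc ∫⁻ y in U, ρ (Metric.closedBall y (1 / ((n : ℝ) + 1))) /
      volume (Metric.closedBall y (1 / ((n : ℝ) + 1)))
      ≤ (∫⁻ y in U, (ρ (Metric.closedBall y (1 / ((n : ℝ) + 1))) /
        volume (Metric.closedBall y (1 / ((n : ℝ) + 1)))) ^ (2 : ℝ)) ^ (1 / 2 : ℝ) *
        (volume U) ^ (1 / 2 : ℝ) := by
        have := ENNReal.lintegral_mul_le_Lp_mul_Lq (volume.restrict U)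
          (Real.HolderConjugate.two_two)
          (f := fun y => ρ (Metric.closedBall y (1 / ((n : ℝ) + 1))) /
            volume (Metric.closedBall y (1 / ((n : ℝ) + 1)))) (g := fun _ => 1)
          ((measurable_measure_closedBall ρ _).div
            (measurable_measure_closedBall volume _)).aemeasurable aemeasurable_const
        simpa only [Pi.mul_apply, mul_one, ENNReal.one_rpow, setLIntegral_one] using this
    _ ≤ _ := by
        simp only [ENNReal.rpow_two]
        gcongr
        exact (setLIntegral_le_lintegral _ _).trans hn.le

theorem absolutelyContinuous_of_lowerEnergy (ρ : Measure ℝ) [IsFiniteMeasure ρ]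
    (h : lowerEnergy ρ < ⊤) : ρ ≪ volume := by
  obtain ⟨M, hM, hM'⟩ := exists_between h
  intro s hs
  have hlim : Tendsto (fun ε : ℝ≥0∞ => M ^ (1 / 2 : ℝ) * ε ^ (1 / 2 : ℝ)) (𝓝[>] 0) (𝓝 0) := by
    have h1 : Tendsto (fun ε : ℝ≥0∞ => ε ^ (1 / 2 : ℝ)) (𝓝[>] 0) (𝓝 0) := by
      have := (ENNReal.continuous_rpow_const (y := (1 / 2 : ℝ))).tendsto 0
      rw [ENNReal.zero_rpow_of_pos (by norm_num)] at this
      exact this.mono_left nhdsWithin_le_nhds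
    have := ENNReal.Tendsto.const_mul (a := M ^ (1 / 2 : ℝ)) h1
      (Or.inr (ENNReal.rpow_ne_top_of_nonneg (by norm_num) hM'.ne))
    simpa using this
  refine le_antisymm (ge_of_tendsto hlim ?_) zero_le
  filter_upwards [self_mem_nhdsWithin] with ε hε
  obtain ⟨U, hsU, hU, hUε⟩ := Set.exists_isOpen_lt_of_lt s ε (by rw [hs]; exact hε)
  calc ρ s ≤ ρ U := measure_mono hsU
    _ ≤ M ^ (1 / 2 : ℝ) * volume U ^ (1 / 2 : ℝ) := measure_le_of_isOpen ρ hM hU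
    _ ≤ _ := by gcongr

/-! ### Disintegration of the occupation measure and continuity in time. -/

/-- Disintegrate the image of `e^(-s) ds` on `[0, ∞)` under `s ↦ (x s, s)` over its first marginal.
The weight makes the measure finite, and the factor `e^s` in the conclusion removes it. The same `ℓ`
and `K` serve every `B`, so at each level the densities form a measure in time. -/
theorem exists_occupation_kernel {x : ℝ → ℝ} (hx : Measurable x)
    (hac : ∀ N : ℕ, occupationMeasure x (Icc 0 N) ≪ volume) :
    ∃ (ℓ : ℝ → ℝ≥0∞) (K : Kernel ℝ ℝ), IsMarkovKernel K ∧ Measurable ℓ ∧ (∀ᵐ y, ℓ y < ⊤) ∧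
      ∀ B, MeasurableSet B → B ⊆ Ici 0 → occupationMeasure x B =
        volume.withDensity (fun y => ℓ y * ∫⁻ s in B, ENNReal.ofReal (Real.exp s) ∂(K y)) := by
  have hexp : Measurable fun s : ℝ => ENNReal.ofReal (Real.exp (-s)) := by fun_prop
  set m : Measure ℝ := (volume.restrict (Ici 0)).withDensity
    fun s => ENNReal.ofReal (Real.exp (-s)) with hm
  have hfin : IsFiniteMeasure m := by
    refine isFiniteMeasure_withDensity ?_
    rw [← ofReal_integral_eq_lintegral_ofReal]
    · exact ENNReal.ofReal_ne_top
    · exact integrableOn_Ici_iff_integrableOn_Ioi (by simp) |>.2 (integrableOn_exp_neg_Ioi 0)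
    · exact Eventually.of_forall fun s => (Real.exp_pos _).le
  have hpair : Measurable fun s => (x s, s) := hx.prodMk measurable_id
  set ρ : Measure (ℝ × ℝ) := m.map fun s => (x s, s) with hρ
  have hfst : ρ.fst ≪ volume := by
    intro A hA
    obtain ⟨A', hAA', hA'm, hA'0⟩ := exists_measurable_superset_of_null hA
    refine measure_mono_null hAA' ?_
    rw [Measure.fst_apply hA'm, hρ, Measure.map_apply hpair (measurable_fst hA'm)]
    refine withDensity_absolutelyContinuous _ _ ?_
    rw [Measure.restrict_apply (hpair (measurable_fst hA'm))]
    refine measure_mono_null (t := ⋃ N : ℕ, x ⁻¹' A' ∩ Icc 0 N) ?_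
      (measure_iUnion_null fun N => ?_)
    · rintro s ⟨h1, h2⟩
      obtain ⟨N, hN⟩ := exists_nat_ge s
      exact mem_iUnion.2 ⟨N, h1, h2, hN⟩
    · have := hac N hA'0
      rwa [occupationMeasure, Measure.map_apply hx hA'm,
        Measure.restrict_apply (hx hA'm)] at this
  refine ⟨ρ.fst.rnDeriv volume, ρ.condKernel, inferInstance, Measure.measurable_rnDeriv _ _,
    Measure.rnDeriv_lt_top _ _, fun B hB hB0 => ?_⟩
  have hgm : Measurable fun y => ∫⁻ s in B, ENNReal.ofReal (Real.exp s) ∂(ρ.condKernel y) :=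
    Measurable.setLIntegral_kernel (by fun_prop) hB
  ext A hA
  rw [withDensity_apply _ hA, setLIntegral_rnDeriv_mul hfst hgm.aemeasurable hA,
    ← Measure.setLIntegral_compProd (f := fun p : ℝ × ℝ => ENNReal.ofReal (Real.exp p.2))
      (by fun_prop) hA hB, ρ.disintegrate, hρ, setLIntegral_map (hA.prod hB) (by fun_prop) hpair,
    occupationMeasure, Measure.map_apply hx hA, Measure.restrict_apply (hx hA), hm,
    setLIntegral_withDensity_eq_setLIntegral_mul _ hexp (by fun_prop) (hpair (hA.prod hB)),
    Measure.restrict_restrict (hpair (hA.prod hB))]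
  have e : (fun s => (x s, s)) ⁻¹' A ×ˢ B ∩ Ici 0 = x ⁻¹' A ∩ B := by
    ext s
    simp only [mem_inter_iff, mem_preimage, mem_prod]
    exact ⟨fun h => h.1, fun h => ⟨h, hB0 h.2⟩⟩
  rw [e, ← setLIntegral_one]
  refine lintegral_congr fun s => ?_
  rw [Pi.mul_apply, ← ENNReal.ofReal_mul (Real.exp_pos _).le, ← Real.exp_add]
  simp

/-- Hypothesis `h1` gives absolute continuity and square integrability. Hypothesis `h2` forces the
time measure at almost every level to be free of atoms, and integrals over `[0, t]` against such a
measure are continuous in `t`. -/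
theorem exists_continuous_localTime {x : ℝ → ℝ} (hx : Measurable x)
    (h1 : ∀ N : ℕ, lowerEnergy (occupationMeasure x (Icc 0 N)) < ⊤)
    (h2 : ∀ N : ℕ, liminf (fun k : ℕ => ∑ j ∈ Finset.range (N * (k + 1)),
      lowerEnergy (occupationMeasure x (Icc ((j : ℝ) / ((k : ℝ) + 1))
        (((j : ℝ) + 1) / ((k : ℝ) + 1))))) atTop = 0) :
    ∃ L : ℝ → ℝ → ℝ, IsLocalTime x L ∧ (∀ᵐ y, ContinuousOn (fun t => L t y) (Ici 0)) ∧
      ∀ t : ℝ, 0 ≤ t → MemLp (L t) 2 volume := by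
  have hfin : ∀ a b : ℝ, IsFiniteMeasure (occupationMeasure x (Icc a b)) := fun a b => by
    unfold occupationMeasure
    infer_instance
  obtain ⟨ℓ, K, hK, hℓm, hℓ, hocc⟩ := exists_occupation_kernel hx fun N =>
    have := hfin 0 N
    absolutelyContinuous_of_lowerEnergy _ (h1 N)
  set D : Set ℝ → ℝ → ℝ≥0∞ :=
    fun B y => ℓ y * ∫⁻ s in B, ENNReal.ofReal (Real.exp s) ∂(K y) with hD
  have hDm : ∀ a b, Measurable (D (Icc a b)) := fun a b =>
    hℓm.mul (Measurable.setLIntegral_kernel (by fun_prop) measurableSet_Icc)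
  have hexpfin : ∀ a b y, ∫⁻ s in Icc a b, ENNReal.ofReal (Real.exp s) ∂(K y) < ⊤ := by
    intro a b y
    calc ∫⁻ s in Icc a b, ENNReal.ofReal (Real.exp s) ∂(K y)
        ≤ ∫⁻ s in Icc a b, ENNReal.ofReal (Real.exp b) ∂(K y) :=
          setLIntegral_mono measurable_const fun s hs =>
            ENNReal.ofReal_le_ofReal (Real.exp_le_exp.2 hs.2)
      _ < ⊤ := by
          rw [setLIntegral_const]
          exact ENNReal.mul_lt_top ENNReal.ofReal_lt_top (measure_lt_top _ _)
  have hDfin : ∀ᵐ y, ∀ a b, D (Icc a b) y < ⊤ := by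
    filter_upwards [hℓ] with y hy a b
    exact ENNReal.mul_lt_top hy (hexpfin a b y)
  have hsq : ∀ a b : ℝ, 0 ≤ a → ∫⁻ y, D (Icc a b) y ^ 2 ≤
      lowerEnergy (occupationMeasure x (Icc a b)) := by
    intro a b ha
    have := hfin a b
    refine le_trans (le_of_eq (lintegral_congr_ae ?_)) (lintegral_rnDeriv_sq_le _)
    have h3 := Measure.rnDeriv_withDensity volume (hDm a b)
    rw [← hocc _ measurableSet_Icc fun s hs => ha.trans hs.1] at h3
    filter_upwards [h3] with y hy
    rw [hy]
  refine ⟨fun t y => (D (Icc 0 t) y).toReal, fun t ht => ⟨(hDm 0 t).ennreal_toReal,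
    fun y => ENNReal.toReal_nonneg, ?_⟩, ?_, fun t ht => ?_⟩
  · rw [hocc _ measurableSet_Icc fun s hs => hs.1]
    refine withDensity_congr_ae ?_
    filter_upwards [hDfin] with y hy
    exact (ENNReal.ofReal_toReal (hy 0 t).ne).symm
  · have hlim : ∀ N : ℕ, ∀ᵐ y, liminf (fun k : ℕ => ∑ j ∈ Finset.range (N * (k + 1)),
        D (Icc ((j : ℝ) / ((k : ℝ) + 1)) (((j : ℝ) + 1) / ((k : ℝ) + 1))) y ^ 2) atTop = 0 := by
      intro N
      have hmeas : ∀ k : ℕ, Measurable fun y => ∑ j ∈ Finset.range (N * (k + 1)),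
          D (Icc ((j : ℝ) / ((k : ℝ) + 1)) (((j : ℝ) + 1) / ((k : ℝ) + 1))) y ^ 2 := fun k =>
        Finset.measurable_fun_sum _ fun j _ => (hDm _ _).pow_const 2
      have := (lintegral_eq_zero_iff (μ := volume) (Measurable.liminf hmeas)).1 (le_antisymm
        ((lintegral_liminf_le hmeas).trans ?_) zero_le)
      · exact this
      · rw [← h2 N]
        refine liminf_le_liminf (Eventually.of_forall fun k => ?_)
        rw [lintegral_finsetSum _ fun j _ => (hDm _ _).pow_const 2]
        exact Finset.sum_le_sum fun j _ => hsq _ _ (by positivity)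
    filter_upwards [ae_all_iff.2 hlim, hℓ] with y hy hℓy
    -- Where `ℓ` vanishes nothing is known about atoms of `K y`, but the density is identically zero
    -- there.
    by_cases hℓ0 : ℓ y = 0
    · simp only [hD, hℓ0, zero_mul, ENNReal.toReal_zero]
      exact continuousOn_const
    have hatom : ∀ s : ℝ, 0 ≤ s → K y {s} = 0 := by
      intro s hs
      obtain ⟨N, hN⟩ := exists_nat_gt s
      have hle : (ℓ y * (ENNReal.ofReal (Real.exp s) * K y {s})) ^ 2 ≤ 0 := by
        rw [← hy N]
        refine le_liminf_of_le (by isBoundedDefault) (Eventually.of_forall fun k => ?_)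
        have hk : (0 : ℝ) < (k : ℝ) + 1 := by positivity
        -- The index of the cell containing `s`; it lies in range because `s < N` strictly. The
        -- summand of this cell alone dominates the contribution of the atom, independently of `k`.
        have hj : ⌊s * (k + 1)⌋₊ ∈ Finset.range (N * (k + 1)) := by
          rw [Finset.mem_range, Nat.floor_lt (by positivity)]
          push_cast
          gcongr
        refine le_trans ?_ (Finset.single_le_sum (f := fun j : ℕ =>
          D (Icc ((j : ℝ) / ((k : ℝ) + 1)) (((j : ℝ) + 1) / ((k : ℝ) + 1))) y ^ 2)
          (fun _ _ => zero_le) hj)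
        have hmem : s ∈ Icc ((⌊s * (k + 1)⌋₊ : ℝ) / ((k : ℝ) + 1))
            (((⌊s * (k + 1)⌋₊ : ℝ) + 1) / ((k : ℝ) + 1)) := by
          rw [mem_Icc, div_le_iff₀ hk, le_div_iff₀ hk]
          exact ⟨Nat.floor_le (by positivity), (Nat.lt_floor_add_one _).le⟩
        simp only [hD]
        gcongr
        calc ENNReal.ofReal (Real.exp s) * K y {s}
            = ∫⁻ r in {s}, ENNReal.ofReal (Real.exp r) ∂(K y) := by
              rw [lintegral_singleton]
          _ ≤ _ := lintegral_mono_set (singleton_subset_iff.2 hmem)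
      have := pow_eq_zero_iff (two_ne_zero) |>.1 (le_antisymm hle zero_le)
      simpa [hℓ0, (Real.exp_pos s).not_ge] using this
    have hna : NullSingletonClass ((K y).restrict (Ici 0)) := ⟨fun s => by
      rw [Measure.restrict_apply (measurableSet_singleton s)]
      by_cases hs : 0 ≤ s
      · exact measure_mono_null inter_subset_left (hatom s hs)
      · rw [singleton_inter_eq_empty.2 (by simpa using hs), measure_empty]⟩
    have heq : ∀ t, (D (Icc 0 t) y).toReal =
        (ℓ y).toReal * ∫ s in Icc 0 t, Real.exp s ∂((K y).restrict (Ici 0)) := by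
      intro t
      rw [hD, ENNReal.toReal_mul, Measure.restrict_restrict measurableSet_Icc,
        inter_eq_left.2 fun s hs => hs.1, integral_eq_lintegral_of_nonneg_ae
          (Eventually.of_forall fun s => (Real.exp_pos s).le)
          (Real.continuous_exp.aestronglyMeasurable)]
    simp only [heq]
    refine continuousOn_const.mul fun t ht => ?_
    -- The endpoint `t + 1` makes the interval a neighbourhood of `t` within `[0, ∞)`.
    have hint : IntegrableOn Real.exp (Icc 0 (t + 1)) ((K y).restrict (Ici 0)) :=
      Real.continuous_exp.continuousOn.integrableOn_Icc
    have hc := intervalIntegral.continuousOn_primitive_Icc hint t ⟨ht, by linarith⟩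
    refine hc.mono_of_mem_nhdsWithin ?_
    rw [← Ici_inter_Iic]
    exact inter_mem_nhdsWithin _ (Iic_mem_nhds (by linarith))
  · obtain ⟨N, hN⟩ := exists_nat_ge t
    refine ⟨(hDm 0 t).ennreal_toReal.aestronglyMeasurable, ?_⟩
    rw [eLpNorm_lt_top_iff_lintegral_rpow_enorm_lt_top (by norm_num) (by norm_num)]
    calc ∫⁻ y, ‖(D (Icc 0 t) y).toReal‖ₑ ^ (2 : ℝ≥0∞).toReal
        ≤ ∫⁻ y, D (Icc 0 N) y ^ 2 := by
          refine lintegral_mono fun y => ?_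
          simp only [ENNReal.toReal_ofNat, ENNReal.rpow_ofNat]
          rw [Real.enorm_of_nonneg ENNReal.toReal_nonneg]
          gcongr
          refine ENNReal.ofReal_toReal_le.trans ?_
          simp only [hD]
          gcongr
      _ < ⊤ := (hsq 0 N le_rfl).trans_lt (h1 N)

/-! ### Energy bounds by pair correlations and Riesz kernels. -/

/-- If `a` lies in the ball of radius `r` about `y`, that ball lies in the ball of radius `2r` about
`a`. Writing one factor of the square as an integral in `a` and applying Tonelli leaves one factor
`2r` from integrating in `y`, against `(2r)⁻²` in the energy. -/
theorem ballEnergy_le (ρ : Measure ℝ) [IsFiniteMeasure ρ] {r : ℝ} (hr : 0 < r) :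
    ballEnergy ρ r ≤ (ENNReal.ofReal (2 * r))⁻¹ *
      ∫⁻ a, ρ (Metric.closedBall a (2 * r)) ∂ρ := by
  set c := ENNReal.ofReal (2 * r) with hc
  have hc0 : c ≠ 0 := by simp [hc, hr]
  have hct : c ≠ ⊤ := ENNReal.ofReal_ne_top
  have hm := measurable_measure_closedBall ρ r
  have hs : MeasurableSet {p : ℝ × ℝ | dist p.2 p.1 ≤ r} :=
    measurableSet_le (by fun_prop) measurable_const
  have h1 : ∫⁻ y, ρ (Metric.closedBall y r) ^ 2 ≤
      c * ∫⁻ a, ρ (Metric.closedBall a (2 * r)) ∂ρ := by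
    calc ∫⁻ y, ρ (Metric.closedBall y r) ^ 2
        = ∫⁻ y, ∫⁻ a, {p : ℝ × ℝ | dist p.2 p.1 ≤ r}.indicator
            (fun p => ρ (Metric.closedBall p.1 r)) (y, a) ∂ρ := by
          refine lintegral_congr fun y => ?_
          rw [sq, ← setLIntegral_const, ← lintegral_indicator Metric.isClosed_closedBall.measurableSet]
          rfl
      _ = ∫⁻ a, (∫⁻ y, {p : ℝ × ℝ | dist p.2 p.1 ≤ r}.indicator
            (fun p => ρ (Metric.closedBall p.1 r)) (y, a)) ∂ρ :=
          lintegral_lintegral_swap (f := fun y a => {p : ℝ × ℝ | dist p.2 p.1 ≤ r}.indicator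
            (fun p => ρ (Metric.closedBall p.1 r)) (y, a))
            ((hm.comp measurable_fst).indicator hs).aemeasurable
      _ ≤ ∫⁻ a, c * ρ (Metric.closedBall a (2 * r)) ∂ρ := by
          refine lintegral_mono fun a => ?_
          calc ∫⁻ y, {p : ℝ × ℝ | dist p.2 p.1 ≤ r}.indicator
                (fun p => ρ (Metric.closedBall p.1 r)) (y, a)
              ≤ ∫⁻ y, (Metric.closedBall a r).indicator
                  (fun _ => ρ (Metric.closedBall a (2 * r))) y := by
                refine lintegral_mono fun y => ?_
                by_cases hy : dist a y ≤ r
                · rw [indicator_of_mem (by exact hy), indicator_of_mem (by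
                    rwa [Metric.mem_closedBall, dist_comm])]
                  refine measure_mono (Metric.closedBall_subset_closedBall' ?_)
                  rw [dist_comm]
                  linarith
                · rw [indicator_of_notMem (by exact hy)]
                  exact zero_le
            _ = c * ρ (Metric.closedBall a (2 * r)) := by
                rw [lintegral_indicator Metric.isClosed_closedBall.measurableSet,
                  setLIntegral_const, Real.volume_closedBall, mul_comm]
      _ = _ := lintegral_const_mul _ (measurable_measure_closedBall ρ _)
  calc ballEnergy ρ r = ∫⁻ y, ρ (Metric.closedBall y r) ^ 2 * (c⁻¹ ^ 2) := by
        simp only [ballEnergy, Real.volume_closedBall, div_eq_mul_inv, mul_pow, ← hc]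
    _ = (∫⁻ y, ρ (Metric.closedBall y r) ^ 2) * (c⁻¹ ^ 2) :=
        lintegral_mul_const _ (hm.pow_const 2)
    _ ≤ (c * ∫⁻ a, ρ (Metric.closedBall a (2 * r)) ∂ρ) * (c⁻¹ ^ 2) := by gcongr
    _ = (c * c⁻¹) * (c⁻¹ * ∫⁻ a, ρ (Metric.closedBall a (2 * r)) ∂ρ) := by ring
    _ = _ := by rw [ENNReal.mul_inv_cancel hc0 hct, one_mul]

/-- The energy `∫∫ |s - t|^(-γ) ds dt` over `I × I`. -/
noncomputable def rieszEnergy (γ : ℝ) (I : Set ℝ) : ℝ≥0∞ :=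
  ∫⁻ s in I, ∫⁻ t in I, ENNReal.ofReal (|s - t| ^ (-γ))

/-- The integral `∫ |w|^(-γ) dw` over `[-h, h]`. -/
noncomputable def rieszBall (γ h : ℝ) : ℝ≥0∞ :=
  ∫⁻ w in Metric.closedBall (0 : ℝ) h, ENNReal.ofReal (|w| ^ (-γ))

theorem rieszEnergy_Icc_le (γ a b : ℝ) :
    rieszEnergy γ (Icc a b) ≤ ENNReal.ofReal (b - a) * rieszBall γ (b - a) := by
  have h1 : ∀ s ∈ Icc a b, ∫⁻ t in Icc a b, ENNReal.ofReal (|s - t| ^ (-γ)) ≤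
      rieszBall γ (b - a) := by
    intro s hs
    rw [rieszBall, ← lintegral_indicator Metric.isClosed_closedBall.measurableSet,
      ← lintegral_sub_left_eq_self (μ := volume) _ s, ← lintegral_indicator measurableSet_Icc]
    refine lintegral_mono fun t => ?_
    by_cases ht : t ∈ Icc a b
    · rw [indicator_of_mem ht, indicator_of_mem]
      rw [mem_closedBall_zero_iff, Real.norm_eq_abs, abs_le]
      constructor <;> linarith [hs.1, hs.2, ht.1, ht.2]
    · rw [indicator_of_notMem ht]
      exact zero_le
  calc rieszEnergy γ (Icc a b) ≤ ∫⁻ s in Icc a b, rieszBall γ (b - a) :=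
        setLIntegral_mono measurable_const h1
    _ = _ := by rw [setLIntegral_const, Real.volume_Icc, mul_comm]

theorem rieszBall_lt_top {γ : ℝ} (hγ : γ < 1) (h : ℝ) : rieszBall γ h < ⊤ := by
  have h0 : LocallyIntegrable (fun w : ℝ => |w| ^ (-γ)) volume := by
    refine locallyIntegrable_of_norm_le_rpow (C := 1) (α := γ) (by simp) (by simpa using hγ)
      (Eventually.of_forall fun w => ?_) (by fun_prop : Measurable _).aestronglyMeasurable
    rw [one_mul, Real.norm_of_nonneg (by positivity), Real.norm_eq_abs]
  have h1 := h0.integrableOn_isCompact (isCompact_closedBall 0 h)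
  rw [rieszBall, ← ofReal_integral_eq_lintegral_ofReal h1
    (Eventually.of_forall fun w => by positivity)]
  exact ENNReal.ofReal_lt_top

theorem tendsto_rieszBall {γ : ℝ} (hγ : γ < 1) :
    Tendsto (fun k : ℕ => rieszBall γ (1 / ((k : ℝ) + 1))) atTop (𝓝 0) := by
  have h1 : ∀ k : ℕ, rieszBall γ (1 / ((k : ℝ) + 1)) =
      ∫⁻ w in Metric.closedBall (0 : ℝ) (1 / ((k : ℝ) + 1)),
        ENNReal.ofReal (|w| ^ (-γ)) ∂(volume.restrict (Metric.closedBall 0 1)) := by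
    intro k
    rw [rieszBall, Measure.restrict_restrict Metric.isClosed_closedBall.measurableSet,
      inter_eq_left.2 (Metric.closedBall_subset_closedBall ?_)]
    rw [div_le_one (by positivity)]
    linarith [(Nat.cast_nonneg k : (0:ℝ) ≤ k)]
  simp only [h1]
  refine tendsto_setLIntegral_zero (rieszBall_lt_top hγ 1).ne ?_
  have h2 : Tendsto (fun k : ℕ => ENNReal.ofReal (2 * (1 / ((k : ℝ) + 1)))) atTop (𝓝 0) := by
    have := (tendsto_one_div_add_atTop_nhds_zero_nat (𝕜 := ℝ)).const_mul 2
    rw [mul_zero] at this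
    simpa only [ENNReal.ofReal_zero] using! (ENNReal.continuous_ofReal.tendsto 0).comp this
  refine tendsto_of_tendsto_of_tendsto_of_le_of_le tendsto_const_nhds h2 (fun _ => zero_le)
    fun k => ?_
  rw [← Real.volume_closedBall 0]
  exact Measure.restrict_apply_le _ _

/-! ### Local times from small-ball estimates for increments. -/

variable {Ω : Type*} [MeasurableSpace Ω] {P : Measure Ω} {X : ℝ → Ω → ℝ}

theorem measurable_ballEnergy_occupation (hX : Measurable (Function.uncurry X)) (a b r : ℝ) :
    Measurable fun u => ballEnergy (occupationMeasure (fun s => X s u) (Icc a b)) r := by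
  have h1 : Measurable fun p : Ω × ℝ => (volume.restrict (Icc a b))
      {s | X s p.1 ∈ Metric.closedBall p.2 r} := by
    have hs : MeasurableSet {q : (Ω × ℝ) × ℝ | dist (X q.2 q.1.1) q.1.2 ≤ r} := by
      refine measurableSet_le (Measurable.dist ?_ (by fun_prop)) measurable_const
      exact hX.comp (measurable_snd.prodMk (measurable_fst.comp measurable_fst))
    exact measurable_measure_prodMk_left hs
  have h2 : Measurable fun p : Ω × ℝ => ((volume.restrict (Icc a b))
      {s | X s p.1 ∈ Metric.closedBall p.2 r} / volume (Metric.closedBall p.2 r)) ^ 2 :=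
    (h1.div ((measurable_measure_closedBall volume r).comp measurable_snd)).pow_const 2
  convert h2.lintegral_prod_right' (ν := volume) using 2 with u
  refine lintegral_congr fun y => ?_
  have hXu : Measurable fun s => X s u := hX.comp (measurable_id.prodMk measurable_const)
  rw [occupationMeasure, Measure.map_apply hXu Metric.isClosed_closedBall.measurableSet]
  rfl

/-- After Tonelli, the expected pair correlation is the double time integral of the small-ball
probabilities at radius `2r`. These are linear in the radius, which cancels the prefactor `(2r)⁻¹`;
hence the bound does not depend on `r`. -/
theorem lintegral_ballEnergy_occupation_le [IsProbabilityMeasure P]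
    (hX : Measurable (Function.uncurry X)) {K : ℝ≥0∞} {γ : ℝ}
    (h : ∀ s t, 0 ≤ s → 0 ≤ t → s ≠ t → ∀ δ, 0 ≤ δ →
      P {u | |X s u - X t u| ≤ δ} ≤ K * ENNReal.ofReal (δ * |s - t| ^ (-γ)))
    {a : ℝ} (ha : 0 ≤ a) (b : ℝ) {r : ℝ} (hr : 0 < r) :
    ∫⁻ u, ballEnergy (occupationMeasure (fun s => X s u) (Icc a b)) r ∂P ≤
      K * rieszEnergy γ (Icc a b) := by
  set c := ENNReal.ofReal (2 * r) with hc
  have hc0 : c ≠ 0 := by simp [hc, hr]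
  have hct : c ≠ ⊤ := ENNReal.ofReal_ne_top
  have hXu : ∀ u, Measurable fun s => X s u := fun u =>
    hX.comp (measurable_id.prodMk measurable_const)
  set S : Set ((Ω × ℝ) × ℝ) := {q | |X q.1.2 q.1.1 - X q.2 q.1.1| ≤ 2 * r} with hS
  have hSm : MeasurableSet S := by
    refine measurableSet_le (Measurable.abs (Measurable.sub ?_ ?_)) measurable_const
    · exact hX.comp ((measurable_snd.comp measurable_fst).prodMk
        (measurable_fst.comp measurable_fst))
    · exact hX.comp (measurable_snd.prodMk (measurable_fst.comp measurable_fst))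
  have hkey : ∀ u, ballEnergy (occupationMeasure (fun s => X s u) (Icc a b)) r ≤
      c⁻¹ * ∫⁻ s in Icc a b, ∫⁻ t in Icc a b, S.indicator (fun _ => (1 : ℝ≥0∞)) ((u, s), t) := by
    intro u
    have : IsFiniteMeasure (occupationMeasure (fun s => X s u) (Icc a b)) := by
      unfold occupationMeasure
      infer_instance
    refine (ballEnergy_le _ hr).trans (le_of_eq ?_)
    congr 1
    have e : ∀ s, occupationMeasure (fun s => X s u) (Icc a b) (Metric.closedBall (X s u) (2 * r))
        = ∫⁻ t in Icc a b, S.indicator (fun _ => (1 : ℝ≥0∞)) ((u, s), t) := by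
      intro s
      rw [occupationMeasure, Measure.map_apply (hXu u) Metric.isClosed_closedBall.measurableSet,
        ← lintegral_indicator_one (hXu u Metric.isClosed_closedBall.measurableSet)]
      refine lintegral_congr fun t => ?_
      simp only [indicator, mem_preimage, Metric.mem_closedBall, dist_comm (X t u), Real.dist_eq,
        hS, mem_ofPred_eq, Pi.one_apply]
    simp only [← e]
    exact lintegral_map (μ := volume.restrict (Icc a b)) (measurable_measure_closedBall _ _) (hXu u)
  have hSi : Measurable (S.indicator fun _ => (1 : ℝ≥0∞)) := measurable_const.indicator hSm
  calc ∫⁻ u, ballEnergy (occupationMeasure (fun s => X s u) (Icc a b)) r ∂P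
      ≤ ∫⁻ u, c⁻¹ * (∫⁻ s in Icc a b, ∫⁻ t in Icc a b,
          S.indicator (fun _ => (1 : ℝ≥0∞)) ((u, s), t)) ∂P := lintegral_mono hkey
    _ = c⁻¹ * ∫⁻ u, (∫⁻ s in Icc a b, ∫⁻ t in Icc a b,
          S.indicator (fun _ => (1 : ℝ≥0∞)) ((u, s), t)) ∂P :=
        lintegral_const_mul _ (hSi.lintegral_prod_right'.lintegral_prod_right')
    _ = c⁻¹ * ∫⁻ s in Icc a b, ∫⁻ u, (∫⁻ t in Icc a b,
          S.indicator (fun _ => (1 : ℝ≥0∞)) ((u, s), t)) ∂P := by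
        congr 1
        exact lintegral_lintegral_swap
          (f := fun u s => ∫⁻ t in Icc a b, S.indicator (fun _ => (1 : ℝ≥0∞)) ((u, s), t))
          hSi.lintegral_prod_right'.aemeasurable
    _ = c⁻¹ * ∫⁻ s in Icc a b, ∫⁻ t in Icc a b, ∫⁻ u,
          S.indicator (fun _ => (1 : ℝ≥0∞)) ((u, s), t) ∂P := by
        congr 1
        refine lintegral_congr fun s => ?_
        exact lintegral_lintegral_swap
          (f := fun u t => S.indicator (fun _ => (1 : ℝ≥0∞)) ((u, s), t))
          (hSi.comp ((measurable_fst.prodMk measurable_const).prodMk measurable_snd)).aemeasurable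
    _ ≤ c⁻¹ * ∫⁻ s in Icc a b, ∫⁻ t in Icc a b, (c * K) * ENNReal.ofReal (|s - t| ^ (-γ)) := by
        gcongr 1
        refine setLIntegral_mono' measurableSet_Icc fun s hs => ?_
        -- The small-ball hypothesis excludes the diagonal, which is a null set.
        have hne : ∀ᵐ t ∂(volume.restrict (Icc a b)), s ≠ t := by
          refine ae_restrict_of_ae ?_
          filter_upwards [compl_mem_ae_iff.2 (measure_singleton (μ := volume) s)] with t ht
          exact fun hst => ht hst.symm
        refine lintegral_mono_ae ?_
        filter_upwards [hne, ae_restrict_mem measurableSet_Icc] with t hst ht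
        calc ∫⁻ u, S.indicator (fun _ => (1 : ℝ≥0∞)) ((u, s), t) ∂P
            = P {u | |X s u - X t u| ≤ 2 * r} := by
              have hm : MeasurableSet {u | |X s u - X t u| ≤ 2 * r} :=
                hSm.preimage ((measurable_id.prodMk measurable_const).prodMk measurable_const)
              rw [← lintegral_indicator_one hm]
              rfl
          _ ≤ K * ENNReal.ofReal (2 * r * |s - t| ^ (-γ)) :=
              h s t (ha.trans hs.1) (ha.trans ht.1) hst _ (by positivity)
          _ = _ := by
              rw [ENNReal.ofReal_mul (by positivity), ← hc]
              ring
    _ = c⁻¹ * ((c * K) * rieszEnergy γ (Icc a b)) := by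
        have hm : Measurable fun p : ℝ × ℝ => ENNReal.ofReal (|p.1 - p.2| ^ (-γ)) := by fun_prop
        rw [rieszEnergy, ← lintegral_const_mul _ hm.lintegral_prod_right']
        congr 1
        refine lintegral_congr fun s => ?_
        exact lintegral_const_mul _ (hm.comp (measurable_const.prodMk measurable_id))
    _ = (c⁻¹ * c) * (K * rieszEnergy γ (Icc a b)) := by ring
    _ = _ := by rw [ENNReal.inv_mul_cancel hc0 hct, one_mul]

/-- Fatou over the probability space reduces both energy conditions on a path to expectations. With
`N (k + 1)` cells of length `1 / (k + 1)`, the lengths sum to `N`, and the remaining factor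
`rieszBall γ (1 / (k + 1))` tends to `0` because `γ < 1`. -/
theorem ae_exists_continuous_localTime [IsProbabilityMeasure P]
    (hX : Measurable (Function.uncurry X)) {K : ℝ≥0∞} (hK : K ≠ ⊤) {γ : ℝ} (hγ : γ < 1)
    (h : ∀ s t, 0 ≤ s → 0 ≤ t → s ≠ t → ∀ δ, 0 ≤ δ →
      P {u | |X s u - X t u| ≤ δ} ≤ K * ENNReal.ofReal (δ * |s - t| ^ (-γ))) :
    ∀ᵐ u ∂P, ∃ L : ℝ → ℝ → ℝ, IsLocalTime (fun s => X s u) L ∧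
      (∀ᵐ y, ContinuousOn (fun t => L t y) (Ici 0)) ∧ ∀ t : ℝ, 0 ≤ t → MemLp (L t) 2 volume := by
  have hm : ∀ a b : ℝ, Measurable fun u =>
      lowerEnergy (occupationMeasure (fun s => X s u) (Icc a b)) := fun a b =>
    Measurable.liminf fun n => measurable_ballEnergy_occupation hX a b _
  have hE : ∀ a b : ℝ, 0 ≤ a →
      ∫⁻ u, lowerEnergy (occupationMeasure (fun s => X s u) (Icc a b)) ∂P ≤
        K * (ENNReal.ofReal (b - a) * rieszBall γ (b - a)) := by
    intro a b ha
    refine (lintegral_liminf_le fun n => measurable_ballEnergy_occupation hX a b _).trans ?_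
    refine liminf_le_of_frequently_le' (Frequently.of_forall fun n => ?_)
    refine (lintegral_ballEnergy_occupation_le hX h ha b (by positivity)).trans ?_
    gcongr
    exact rieszEnergy_Icc_le γ a b
  have h1 : ∀ᵐ u ∂P, ∀ N : ℕ, lowerEnergy (occupationMeasure (fun s => X s u) (Icc 0 N)) < ⊤ := by
    refine ae_all_iff.2 fun N => ae_lt_top (hm _ _) ((hE 0 N le_rfl).trans_lt ?_).ne
    exact ENNReal.mul_lt_top hK.lt_top (ENNReal.mul_lt_top ENNReal.ofReal_lt_top
      (rieszBall_lt_top hγ _))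
  have h2 : ∀ᵐ u ∂P, ∀ N : ℕ, liminf (fun k : ℕ => ∑ j ∈ Finset.range (N * (k + 1)),
      lowerEnergy (occupationMeasure (fun s => X s u) (Icc ((j : ℝ) / ((k : ℝ) + 1))
        (((j : ℝ) + 1) / ((k : ℝ) + 1))))) atTop = 0 := by
    refine ae_all_iff.2 fun N => ?_
    have hm' : ∀ k : ℕ, Measurable fun u => ∑ j ∈ Finset.range (N * (k + 1)),
        lowerEnergy (occupationMeasure (fun s => X s u) (Icc ((j : ℝ) / ((k : ℝ) + 1))
          (((j : ℝ) + 1) / ((k : ℝ) + 1)))) := fun k =>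
      Finset.measurable_fun_sum _ fun j _ => hm _ _
    refine (lintegral_eq_zero_iff (Measurable.liminf hm')).1 (le_antisymm
      ((lintegral_liminf_le hm').trans ?_) zero_le)
    have hlim : Tendsto (fun k : ℕ => (N : ℝ≥0∞) * K * rieszBall γ (1 / ((k : ℝ) + 1))) atTop
        (𝓝 0) := by
      have := ENNReal.Tendsto.const_mul (a := (N : ℝ≥0∞) * K) (tendsto_rieszBall hγ)
        (Or.inr (ENNReal.mul_ne_top (ENNReal.natCast_ne_top N) hK))
      simpa using this
    rw [← hlim.liminf_eq]
    refine liminf_le_liminf (Eventually.of_forall fun k => ?_)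
    have hk : (0 : ℝ) < (k : ℝ) + 1 := by positivity
    rw [lintegral_finsetSum _ fun j _ => hm _ _]
    calc _ ≤ ∑ j ∈ Finset.range (N * (k + 1)), K * (ENNReal.ofReal (1 / ((k : ℝ) + 1)) *
            rieszBall γ (1 / ((k : ℝ) + 1))) := by
          refine Finset.sum_le_sum fun j _ => (hE _ _ (by positivity)).trans (le_of_eq ?_)
          have : ((j : ℝ) + 1) / ((k : ℝ) + 1) - (j : ℝ) / ((k : ℝ) + 1) = 1 / ((k : ℝ) + 1) := by
            ring
          rw [this]
      _ = N * K * rieszBall γ (1 / ((k : ℝ) + 1)) *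
            (ENNReal.ofReal ((k : ℝ) + 1) * ENNReal.ofReal (1 / ((k : ℝ) + 1))) := by
          rw [Finset.sum_const, Finset.card_range, nsmul_eq_mul]
          have : ENNReal.ofReal ((k : ℝ) + 1) = (k : ℝ≥0∞) + 1 := by
            rw [ENNReal.ofReal_add (by positivity) (by positivity)]
            simp
          rw [this]
          push_cast
          ring
      _ = _ := by
          rw [← ENNReal.ofReal_mul hk.le, mul_one_div_cancel hk.ne', ENNReal.ofReal_one, mul_one]
  filter_upwards [h1, h2] with u hu1 hu2
  exact exists_continuous_localTime (hX.comp (measurable_id.prodMk measurable_const)) hu1 hu2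

end BGM

namespace BGM

open ENNReal NNReal

/-! ### Increments of kernels -/

theorem tendsto_eLpNorm_translate {g : ℝ → ℝ} (hg : MemLp g 2 volume) :
    Tendsto (fun h : ℝ => eLpNorm (fun w => g (h + w) - g w) 2 volume) (𝓝 0) (𝓝 0) := by
  have : Fact ((2 : ℝ≥0∞) ≠ ⊤) := ⟨by norm_num⟩
  have hc : Continuous fun h : ℝ => DomAddAct.mk h +ᵥ hg.toLp g :=
    (DomAddAct.continuous_mk).vadd continuous_const
  have h1 := hc.tendsto 0
  rw [Lp.tendsto_Lp_iff_tendsto_eLpNorm'] at h1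
  refine h1.congr fun h => eLpNorm_congr_ae ?_
  have e0 : DomAddAct.mk (0 : ℝ) +ᵥ hg.toLp g = hg.toLp g := by simp
  have hm := hg.comp_measurePreserving (measurePreserving_add_left volume h)
  have e1 : DomAddAct.mk h +ᵥ hg.toLp g = hm.toLp _ := DomAddAct.mk_vadd_toLp h hg
  rw [e0, e1]
  filter_upwards [hg.coeFn_toLp, hm.coeFn_toLp] with w h1 h2
  simp [h1, h2]

/-- `k` vanishes on `(-∞, 0]`, is locally square integrable, and its increments on `(1, ∞)` are
dominated by the integrals of the square integrable function `q`. -/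
structure IsL2Kernel (k q : ℝ → ℝ) : Prop where
  zero : ∀ x, x ≤ 0 → k x = 0
  memLp_Ioo : ∀ R, MemLp k 2 (volume.restrict (Ioo 0 R))
  memLp_deriv : MemLp q 2 (volume.restrict (Ioi 1))
  enorm_sub_le : ∀ y h, 1 < y → 0 ≤ h → ‖k (h + y) - k y‖ₑ ≤ ∫⁻ z in Ioc y (h + y), ‖q z‖ₑ

/-- The increment `k(t - x) - k(-x)`. -/
def kernelIncrement (k : ℝ → ℝ) (t x : ℝ) : ℝ := k (t - x) - k (-x)

theorem eLpNorm_kernelIncrement (k : ℝ → ℝ) (t : ℝ)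
    (hk : AEStronglyMeasurable k volume) :
    eLpNorm (kernelIncrement k t) 2 volume = eLpNorm (fun w => k (t + w) - k w) 2 volume := by
  have hm : AEStronglyMeasurable (fun w => k (t + w) - k w) volume :=
    (hk.comp_measurePreserving (measurePreserving_add_left volume t)).sub hk
  rw [← eLpNorm_comp_measurePreserving hm (Measure.measurePreserving_neg volume)]
  rfl

/-- Stationarity of increments: up to sign, the difference is a translate by `s` of the increment
over `t - s`. -/
theorem eLpNorm_kernelIncrement_sub (k : ℝ → ℝ) (s t : ℝ)
    (hk : AEStronglyMeasurable k volume) :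
    eLpNorm (fun x => kernelIncrement k s x - kernelIncrement k t x) 2 volume =
      eLpNorm (kernelIncrement k (t - s)) 2 volume := by
  have hm : AEStronglyMeasurable (kernelIncrement k (t - s)) volume :=
    (hk.comp_measurePreserving (Measure.measurePreserving_sub_left volume (t - s))).sub
      (hk.comp_measurePreserving (Measure.measurePreserving_neg volume))
  rw [← eLpNorm_comp_measurePreserving hm (measurePreserving_sub_right volume s), ← eLpNorm_neg]
  congr 1
  ext x
  simp only [kernelIncrement, Pi.neg_apply, Function.comp_apply]
  ring_nf

namespace IsL2Kernel

variable {k q : ℝ → ℝ}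

theorem memLp_indicator (hk : IsL2Kernel k q) (R : ℝ) : MemLp ((Iio R).indicator k) 2 volume := by
  have h1 : (Iio R).indicator k = (Ioo 0 R).indicator k := by
    ext x
    by_cases hx : 0 < x
    · by_cases hR : x < R
      · rw [indicator_of_mem (by exact hR), indicator_of_mem (by exact ⟨hx, hR⟩)]
      · rw [indicator_of_notMem (by exact hR), indicator_of_notMem (fun h => hR h.2)]
    · rw [indicator_of_notMem (s := Ioo 0 R) (fun h => hx h.1)]
      by_cases hR : x < R
      · rw [indicator_of_mem (by exact hR), hk.zero x (not_lt.1 hx)]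
      · rw [indicator_of_notMem (by exact hR)]
  rw [h1, memLp_indicator_iff_restrict measurableSet_Ioo]
  exact hk.memLp_Ioo R

theorem aestronglyMeasurable (hk : IsL2Kernel k q) : AEStronglyMeasurable k volume := by
  refine aestronglyMeasurable_of_tendsto_ae atTop
    (fun n : ℕ => (hk.memLp_indicator (n : ℝ)).1) (Eventually.of_forall fun x => ?_)
  obtain ⟨N, hN⟩ := exists_nat_gt x
  refine tendsto_const_nhds.congr' ?_
  filter_upwards [eventually_ge_atTop N] with n hn
  rw [indicator_of_mem]
  exact hN.trans_le (by exact_mod_cast hn)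

/-- Cauchy–Schwarz on an interval of length `h` gives one factor `h`. Tonelli gives the other, since
each `z` belongs to `(w, h + w]` for a set of `w` of length `h`. -/
theorem lintegral_increment_sq_le (hk : IsL2Kernel k q) {h : ℝ} (hh : 0 ≤ h) :
    ∫⁻ w in Ioi 1, ‖k (h + w) - k w‖ₑ ^ 2 ≤
      ENNReal.ofReal h ^ 2 * ∫⁻ z in Ioi 1, ‖q z‖ₑ ^ 2 := by
  -- Tonelli needs a measurable representative, as `q` is only almost everywhere measurable on `(1,
  -- ∞)`.
  obtain ⟨Q, hQm, hQ⟩ : ∃ Q : ℝ → ℝ≥0∞, Measurable Q ∧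
      (fun z => ‖q z‖ₑ) =ᵐ[volume.restrict (Ioi 1)] Q :=
    ⟨_, hk.memLp_deriv.1.enorm.measurable_mk, hk.memLp_deriv.1.enorm.ae_eq_mk⟩
  have hS : MeasurableSet {p : ℝ × ℝ | p.1 < p.2 ∧ p.2 ≤ h + p.1} :=
    (measurableSet_lt measurable_fst measurable_snd).inter
      (measurableSet_le measurable_snd (by fun_prop))
  have h1 : ∀ w ∈ Ioi (1 : ℝ), ‖k (h + w) - k w‖ₑ ^ 2 ≤ ENNReal.ofReal h *
      ∫⁻ z in Ioi 1, {p : ℝ × ℝ | p.1 < p.2 ∧ p.2 ≤ h + p.1}.indicator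
        (fun p => Q p.2 ^ 2) (w, z) := by
    intro w hw
    have hsub : Ioc w (h + w) ⊆ Ioi 1 := fun z hz => lt_trans hw hz.1
    have h2 : ∫⁻ z in Ioc w (h + w), ‖q z‖ₑ = ∫⁻ z in Ioc w (h + w), Q z :=
      lintegral_congr_ae (ae_restrict_of_ae_restrict_of_subset hsub hQ)
    have h3 := ENNReal.lintegral_mul_le_Lp_mul_Lq (volume.restrict (Ioc w (h + w)))
      Real.HolderConjugate.two_two (f := Q) (g := fun _ => 1) hQm.aemeasurable aemeasurable_const
    simp only [Pi.mul_apply, mul_one, ENNReal.one_rpow, setLIntegral_one, Real.volume_Ioc,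
      add_sub_cancel_right] at h3
    simp only [ENNReal.rpow_two] at h3
    have h4 : ∫⁻ z in Ioi 1, {p : ℝ × ℝ | p.1 < p.2 ∧ p.2 ≤ h + p.1}.indicator
        (fun p => Q p.2 ^ 2) (w, z) = ∫⁻ z in Ioc w (h + w), Q z ^ 2 := by
      have : ∀ z, {p : ℝ × ℝ | p.1 < p.2 ∧ p.2 ≤ h + p.1}.indicator (fun p => Q p.2 ^ 2) (w, z) =
          (Ioc w (h + w)).indicator (fun z => Q z ^ 2) z := fun z => rfl
      simp only [this]
      rw [lintegral_indicator measurableSet_Ioc, Measure.restrict_restrict measurableSet_Ioc,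
        inter_eq_left.2 hsub]
    calc ‖k (h + w) - k w‖ₑ ^ 2 ≤ (∫⁻ z in Ioc w (h + w), Q z) ^ 2 := by
          rw [← h2]
          exact pow_le_pow_left' (hk.enorm_sub_le w h hw hh) 2
      _ ≤ ((∫⁻ z in Ioc w (h + w), Q z ^ 2) ^ (1 / 2 : ℝ) * ENNReal.ofReal h ^ (1 / 2 : ℝ)) ^ 2 :=
          pow_le_pow_left' h3 2
      _ = _ := by
          have e : ∀ c : ℝ≥0∞, (c ^ (1 / 2 : ℝ)) ^ 2 = c := fun c => by
            rw [← ENNReal.rpow_natCast, ← ENNReal.rpow_mul]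
            norm_num
          rw [mul_pow, e, e, h4, mul_comm]
  have hmeas : Measurable fun p : ℝ × ℝ => {p : ℝ × ℝ | p.1 < p.2 ∧ p.2 ≤ h + p.1}.indicator
        (fun p => Q p.2 ^ 2) p := ((hQm.comp measurable_snd).pow_const 2).indicator hS
  calc ∫⁻ w in Ioi 1, ‖k (h + w) - k w‖ₑ ^ 2
      ≤ ∫⁻ w in Ioi 1, ENNReal.ofReal h *
      ∫⁻ z in Ioi 1, {p : ℝ × ℝ | p.1 < p.2 ∧ p.2 ≤ h + p.1}.indicator
        (fun p => Q p.2 ^ 2) (w, z) := setLIntegral_mono' measurableSet_Ioi h1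
    _ = ENNReal.ofReal h * ∫⁻ w in Ioi 1,
      ∫⁻ z in Ioi 1, {p : ℝ × ℝ | p.1 < p.2 ∧ p.2 ≤ h + p.1}.indicator
        (fun p => Q p.2 ^ 2) (w, z) := lintegral_const_mul _ hmeas.lintegral_prod_right'
    _ = ENNReal.ofReal h * ∫⁻ z in Ioi 1,
      ∫⁻ w in Ioi 1, {p : ℝ × ℝ | p.1 < p.2 ∧ p.2 ≤ h + p.1}.indicator
        (fun p => Q p.2 ^ 2) (w, z) := by
        congr 1
        exact lintegral_lintegral_swap (f := fun w z =>
          {p : ℝ × ℝ | p.1 < p.2 ∧ p.2 ≤ h + p.1}.indicator (fun p => Q p.2 ^ 2) (w, z))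
          hmeas.aemeasurable
    _ ≤ ENNReal.ofReal h * ∫⁻ z in Ioi 1, ENNReal.ofReal h * Q z ^ 2 := by
        gcongr with z
        refine (setLIntegral_le_lintegral _ _).trans ?_
        calc ∫⁻ w, {p : ℝ × ℝ | p.1 < p.2 ∧ p.2 ≤ h + p.1}.indicator (fun p => Q p.2 ^ 2) (w, z)
            = ∫⁻ w, (Ico (z - h) z).indicator (fun _ => Q z ^ 2) w := by
              refine lintegral_congr fun w => ?_
              simp only [indicator, mem_ofPred_eq, mem_Ico, sub_le_iff_le_add']
              congr 1
              rw [and_comm]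
          _ ≤ _ := by
              rw [lintegral_indicator measurableSet_Ico, setLIntegral_const, Real.volume_Ico,
                _root_.sub_sub_cancel, mul_comm]
    _ = ENNReal.ofReal h ^ 2 * ∫⁻ z in Ioi 1, ‖q z‖ₑ ^ 2 := by
        rw [lintegral_const_mul _ (hQm.pow_const 2), ← mul_assoc, ← sq]
        congr 1
        refine lintegral_congr_ae ?_
        filter_upwards [hQ] with z hz
        rw [← hz]

/-- Split at `w = 1`. To the left, both arguments are below `R`, so the truncation at `R` is
invisible; to the right, the bound through `q` applies. The kernel itself need not be square
integrable at infinity. -/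
theorem eLpNorm_increment_le (hk : IsL2Kernel k q) {h R : ℝ} (hh : 0 ≤ h) (hR : h + 1 < R) :
    eLpNorm (fun w => k (h + w) - k w) 2 volume ≤
      eLpNorm (fun w => (Iio R).indicator k (h + w) - (Iio R).indicator k w) 2 volume +
        ENNReal.ofReal h * eLpNorm q 2 (volume.restrict (Ioi 1)) := by
  have hm : AEStronglyMeasurable (fun w => k (h + w) - k w) volume :=
    (hk.aestronglyMeasurable.comp_measurePreserving (measurePreserving_add_left volume h)).sub
      hk.aestronglyMeasurable
  have h1 : eLpNorm (fun w => k (h + w) - k w) 2 volume ≤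
      eLpNorm (fun w => k (h + w) - k w) 2 (volume.restrict (Iic 1)) +
        eLpNorm (fun w => k (h + w) - k w) 2 (volume.restrict (Ioi 1)) := by
    rw [← eLpNorm_indicator_eq_eLpNorm_restrict measurableSet_Iic,
      ← eLpNorm_indicator_eq_eLpNorm_restrict measurableSet_Ioi]
    refine le_trans (le_of_eq ?_) (eLpNorm_add_le (hm.indicator measurableSet_Iic)
      (hm.indicator measurableSet_Ioi) (by norm_num))
    congr 1
    rw [← compl_Iic, indicator_self_add_compl]
  refine h1.trans (add_le_add ?_ ?_)
  · refine le_trans (le_of_eq (eLpNorm_congr_ae ?_)) (eLpNorm_restrict_le _ _ _ (Iic 1))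
    filter_upwards [ae_restrict_mem measurableSet_Iic] with w hw
    rw [mem_Iic] at hw
    rw [indicator_of_mem (by rw [mem_Iio]; linarith), indicator_of_mem (by rw [mem_Iio]; linarith)]
  · have e : ∀ (f : ℝ → ℝ) (ρ : Measure ℝ),
        eLpNorm f 2 ρ = (∫⁻ w, ‖f w‖ₑ ^ 2 ∂ρ) ^ (1 / 2 : ℝ) := fun f ρ => by
      rw [eLpNorm_eq_lintegral_rpow_enorm_toReal (by norm_num) (by norm_num)]
      simp
    rw [e, e]
    calc _ ≤ (ENNReal.ofReal h ^ 2 * ∫⁻ z in Ioi 1, ‖q z‖ₑ ^ 2) ^ (1 / 2 : ℝ) := by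
          gcongr
          exact hk.lintegral_increment_sq_le hh
      _ = _ := by
          rw [ENNReal.mul_rpow_of_nonneg _ _ (by norm_num), ← ENNReal.rpow_natCast,
            ← ENNReal.rpow_mul]
          norm_num

theorem memLp_kernelIncrement (hk : IsL2Kernel k q) {t : ℝ} (ht : 0 ≤ t) :
    MemLp (kernelIncrement k t) 2 volume := by
  refine ⟨(hk.aestronglyMeasurable.comp_measurePreserving
    (Measure.measurePreserving_sub_left volume t)).sub (hk.aestronglyMeasurable.comp_measurePreserving
      (Measure.measurePreserving_neg volume)), ?_⟩
  rw [eLpNorm_kernelIncrement k t hk.aestronglyMeasurable]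
  refine (hk.eLpNorm_increment_le ht (R := t + 2) (by linarith)).trans_lt ?_
  have hg := hk.memLp_indicator (t + 2)
  exact ENNReal.add_lt_top.2 ⟨((hg.comp_measurePreserving
    (measurePreserving_add_left volume t)).sub hg).2,
    ENNReal.mul_lt_top ENNReal.ofReal_lt_top hk.memLp_deriv.2⟩

theorem tendsto_eLpNorm_kernelIncrement (hk : IsL2Kernel k q) :
    Tendsto (fun h => eLpNorm (kernelIncrement k h) 2 volume) (𝓝[≥] 0) (𝓝 0) := by
  -- The truncation point `3` exceeds `h + 1` for every `h < 1`, so a single `L²` function serves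
  -- all small `h`.
  have h1 : Tendsto (fun h : ℝ =>
      eLpNorm (fun w => (Iio 3).indicator k (h + w) - (Iio 3).indicator k w) 2 volume +
        ENNReal.ofReal h * eLpNorm q 2 (volume.restrict (Ioi 1))) (𝓝[≥] 0) (𝓝 0) := by
    have h2 := (tendsto_eLpNorm_translate (hk.memLp_indicator 3)).mono_left
      (nhdsWithin_le_nhds (s := Ici 0))
    have h3 : Tendsto (fun h : ℝ => ENNReal.ofReal h * eLpNorm q 2 (volume.restrict (Ioi 1)))
        (𝓝[≥] 0) (𝓝 (ENNReal.ofReal 0 * eLpNorm q 2 (volume.restrict (Ioi 1)))) :=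
      ENNReal.Tendsto.mul_const ((ENNReal.continuous_ofReal.tendsto 0).mono_left
        nhdsWithin_le_nhds) (Or.inr hk.memLp_deriv.2.ne)
    simpa using h2.add h3
  refine tendsto_of_tendsto_of_tendsto_of_le_of_le' tendsto_const_nhds h1
    (Eventually.of_forall fun _ => zero_le) ?_
  filter_upwards [self_mem_nhdsWithin, mem_nhdsWithin_of_mem_nhds (Iio_mem_nhds one_pos)]
    with h hh hh1
  rw [eLpNorm_kernelIncrement k h hk.aestronglyMeasurable]
  exact hk.eLpNorm_increment_le hh (by rw [mem_Iio] at hh1; linarith)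

end IsL2Kernel

theorem soninePrimitive_of_nonpos (g : ℝ → ℝ) {x : ℝ} (hx : x ≤ 0) : soninePrimitive g x = 0 := by
  rw [soninePrimitive, Ioo_eq_empty (not_lt.2 hx), setIntegral_empty]

theorem soninePrimitive_sub {g : ℝ → ℝ} (hg : ∀ T, 0 < T → IntegrableOn g (Ioo 0 T) volume)
    {a b : ℝ} (hab : a ≤ b) :
    soninePrimitive g b - soninePrimitive g a = ∫ w in Ico a b ∩ Ioi 0, g w := by
  rcases le_or_gt b 0 with hb | hb
  · have : Ico a b ∩ Ioi 0 = ∅ := by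
      ext w
      simp only [mem_inter_iff, mem_Ico, mem_Ioi, mem_empty_iff_false, iff_false, not_and, not_lt]
      exact fun h => h.2.le.trans hb
    rw [this, setIntegral_empty, soninePrimitive_of_nonpos g hb,
      soninePrimitive_of_nonpos g (hab.trans hb), sub_zero]
  · rw [soninePrimitive, soninePrimitive, ← setIntegral_sdiff measurableSet_Ioo (hg b hb)
      (Ioo_subset_Ioo_right hab)]
    congr 2
    ext w
    simp only [Set.mem_sdiff, mem_Ioo, mem_inter_iff, mem_Ico, mem_Ioi, not_and, not_lt]
    exact ⟨fun h => ⟨⟨h.2 h.1.1, h.1.2⟩, h.1.1⟩, fun h => ⟨⟨h.2, h.1.2⟩, fun _ => h.1.1⟩⟩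

/-- The substitution `w = t - x` under the integral reduces the operator to an increment of the
primitive of `g`. With `g = κ` this settles the integral case; with `g = ν` it is the function still
to be differentiated. -/
theorem rightIntegral_indicator_Ico {g : ℝ → ℝ}
    (hg : ∀ T, 0 < T → IntegrableOn g (Ioo 0 T) volume) {t : ℝ} (ht : 0 ≤ t) (x : ℝ) :
    rightIntegral g ((Ico 0 t).indicator 1) x = kernelIncrement (soninePrimitive g) t x := by
  rw [kernelIncrement, soninePrimitive_sub hg (by linarith), rightIntegral,
    ← integral_indicator measurableSet_Ioi,
    ← integral_indicator (measurableSet_Ico.inter measurableSet_Ioi),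
    ← integral_sub_right_eq_self (fun w => (Ico (-x) (t - x) ∩ Ioi 0).indicator g w) x]
  congr 1
  ext s
  by_cases h1 : x < s
  · by_cases h2 : s ∈ Ico 0 t
    · rw [indicator_of_mem (by exact h1), indicator_of_mem h2, indicator_of_mem]
      · simp
      · exact ⟨⟨by linarith [h2.1], by linarith [h2.2]⟩, by rw [mem_Ioi]; linarith⟩
    · rw [indicator_of_mem (by exact h1), indicator_of_notMem h2, indicator_of_notMem, zero_mul]
      exact fun h => h2 ⟨by linarith [h.1.1], by linarith [h.1.2]⟩
  · rw [indicator_of_notMem (by exact h1), indicator_of_notMem]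
    intro h
    have := mem_Ioi.1 h.2
    exact h1 (by linarith)

/-! ### The distributional derivative of an increment of a primitive. -/

section Primitive

variable {g : ℝ → ℝ}

theorem integrableOn_Iio_of_zero (h0 : ∀ x, x ≤ 0 → g x = 0)
    (hg : ∀ T, 0 < T → IntegrableOn g (Ioo 0 T) volume) (T : ℝ) : IntegrableOn g (Iio T) := by
  have h1 : IntegrableOn g (Iic 0) :=
    (integrableOn_zero (μ := volume)).congr_fun (fun x hx => (h0 x hx).symm) measurableSet_Iic
  refine (h1.union (hg (max T 1) (by simp))).mono_set fun x hx => ?_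
  rcases le_or_gt x 0 with h | h
  · exact Or.inl h
  · exact Or.inr ⟨h, lt_max_of_lt_left hx⟩

theorem locallyIntegrable_of_zero (h0 : ∀ x, x ≤ 0 → g x = 0)
    (hg : ∀ T, 0 < T → IntegrableOn g (Ioo 0 T) volume) : LocallyIntegrable g volume := fun x =>
  ⟨Iio (x + 1), Iio_mem_nhds (by linarith), integrableOn_Iio_of_zero h0 hg _⟩

theorem soninePrimitive_eq_integral_Iio (h0 : ∀ x, x ≤ 0 → g x = 0) (y : ℝ) :
    soninePrimitive g y = ∫ z in Iio y, g z := by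
  refine setIntegral_eq_of_subset_of_forall_sdiff_eq_zero measurableSet_Iio
    (fun z hz => hz.2) (fun z hz => h0 z ?_) |>.symm
  by_contra h
  exact hz.2 ⟨not_le.1 h, hz.1⟩

theorem continuous_soninePrimitive (h0 : ∀ x, x ≤ 0 → g x = 0)
    (hg : ∀ T, 0 < T → IntegrableOn g (Ioo 0 T) volume) : Continuous (soninePrimitive g) := by
  have h1 : soninePrimitive g = fun y => ∫ z in (0 : ℝ)..y, g z := by
    ext y
    rcases le_total 0 y with hy | hy
    · rw [intervalIntegral.integral_of_le hy, soninePrimitive, integral_Ioc_eq_integral_Ioo]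
    · rw [intervalIntegral.integral_of_ge hy, soninePrimitive_of_nonpos g hy,
        setIntegral_eq_zero_of_forall_eq_zero fun z hz => h0 z hz.2, neg_zero]
  rw [h1]
  exact intervalIntegral.continuous_primitive
    (fun a b => ((locallyIntegrable_of_zero h0 hg).integrableOn_isCompact
      isCompact_uIcc).intervalIntegrable) 0

/-- Integration by parts for a merely integrable kernel: Fubini over `z < t - x` leaves the integral
of `deriv q` over a half-line, which is a value of `q`. -/
theorem integral_soninePrimitive_mul_deriv (h0 : ∀ x, x ≤ 0 → g x = 0)
    (hg : ∀ T, 0 < T → IntegrableOn g (Ioo 0 T) volume) {q : ℝ → ℝ} (hq : ContDiff ℝ ∞ q)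
    (hqc : HasCompactSupport q) (t : ℝ) :
    ∫ x, soninePrimitive g (t - x) * deriv q x = ∫ x, g (t - x) * q x := by
  have hq1 : Continuous (deriv q) := hq.continuous_deriv (by norm_num)
  have hqc1 : HasCompactSupport (deriv q) := hqc.deriv
  have hqi : Integrable (deriv q) := hq1.integrable_of_hasCompactSupport hqc1
  obtain ⟨R, hR⟩ := hqc1.isCompact.isBounded.subset_closedBall 0
  have hR' : ∀ x, deriv q x ≠ 0 → -R ≤ x := fun x hx => by
    have := hR (subset_tsupport _ hx)
    rw [mem_closedBall_zero_iff, Real.norm_eq_abs, abs_le] at this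
    exact this.1
  set F : ℝ → ℝ → ℝ := fun x z => (Iio (t - x)).indicator g z * deriv q x with hF
  -- On the support of `deriv q` one has `-R ≤ x`, so `z < t - x` forces `z < t + R`; the truncated
  -- kernel is integrable on the whole line.
  have hgT : Integrable ((Iio (t + R)).indicator g) :=
    (integrable_indicator_iff measurableSet_Iio).2 (integrableOn_Iio_of_zero h0 hg _)
  have hFi : Integrable (Function.uncurry F) (volume.prod volume) := by
    have h1 : Integrable (fun p : ℝ × ℝ => deriv q p.1 * (Iio (t + R)).indicator g p.2)
        (volume.prod volume) := hqi.mul_prod hgT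
    have hS : MeasurableSet {p : ℝ × ℝ | p.2 < t - p.1} :=
      measurableSet_lt measurable_snd (by fun_prop)
    refine (h1.indicator hS).congr (Eventually.of_forall fun p => ?_)
    rcases p with ⟨x, z⟩
    simp only [Function.uncurry, hF]
    by_cases hz : z < t - x
    · rw [indicator_of_mem (s := {p : ℝ × ℝ | p.2 < t - p.1}) (by exact hz),
        indicator_of_mem (s := Iio (t - x)) (by exact hz)]
      by_cases hx : deriv q x = 0
      · simp [hx]
      · rw [indicator_of_mem (by rw [mem_Iio]; linarith [hR' x hx]), mul_comm]
    · rw [indicator_of_notMem (s := {p : ℝ × ℝ | p.2 < t - p.1}) (by exact hz),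
        indicator_of_notMem (s := Iio (t - x)) (by exact hz), zero_mul]
  calc ∫ x, soninePrimitive g (t - x) * deriv q x = ∫ x, ∫ z, F x z := by
        congr 1
        ext x
        rw [soninePrimitive_eq_integral_Iio h0, ← integral_indicator measurableSet_Iio,
          ← integral_mul_const]
    _ = ∫ z, ∫ x, F x z := integral_integral_swap hFi
    _ = ∫ z, g z * q (t - z) := by
        congr 1
        ext z
        have h1 : ∀ x, F x z = g z * (Iio (t - z)).indicator (deriv q) x := by
          intro x
          simp only [hF]
          by_cases hz : z < t - x
          · rw [indicator_of_mem (by exact hz), indicator_of_mem (by rw [mem_Iio]; linarith)]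
          · rw [indicator_of_notMem (by exact hz),
              indicator_of_notMem (by rw [mem_Iio]; intro h; exact hz (by linarith)), zero_mul,
              mul_zero]
        simp only [h1]
        rw [integral_const_mul, integral_indicator measurableSet_Iio, ← integral_Iic_eq_integral_Iio,
          hqc.integral_Iic_deriv_eq (hq.of_le (by norm_num))]
    _ = _ := by
        rw [← integral_sub_left_eq_self _ volume t]
        simp

theorem isRightDerivative_kernelIncrement (h0 : ∀ x, x ≤ 0 → g x = 0)
    (hg : ∀ T, 0 < T → IntegrableOn g (Ioo 0 T) volume) {t : ℝ} (ht : 0 ≤ t) :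
    IsRightDerivative g ((Ico 0 t).indicator 1) (kernelIncrement g t) := by
  have hr : rightIntegral g ((Ico 0 t).indicator 1) = kernelIncrement (soninePrimitive g) t :=
    funext fun x => rightIntegral_indicator_Ico hg ht x
  have hc := continuous_soninePrimitive h0 hg
  have hli : ∀ s, LocallyIntegrable (fun x => g (s - x)) volume := by
    intro s x
    refine ⟨Ioi (x - 1), Ioi_mem_nhds (by linarith), ?_⟩
    have h1 := (Measure.measurePreserving_sub_left volume s).integrableOn_comp_preimage
      (MeasurableEquiv.subLeft s).measurableEmbedding (f := g) (s := Iio (s - (x - 1)))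
    have h2 := h1.2 (integrableOn_Iio_of_zero h0 hg _)
    simpa [Function.comp_def] using! h2
  have hli' : LocallyIntegrable (kernelIncrement g t) volume := by
    have := (hli t).sub (hli 0)
    simp only [zero_sub] at this
    exact this
  refine ⟨?_, hli', fun q hq hqc => ?_⟩
  · rw [hr]
    exact (((hc.comp (by fun_prop : Continuous fun x : ℝ => t - x)).sub
      (hc.comp (by fun_prop : Continuous fun x : ℝ => -x)))).locallyIntegrable
  · have hq1 : Continuous (deriv q) := hq.continuous_deriv (by norm_num)
    have e1 : ∀ s, Integrable fun x => g (s - x) * q x := fun s => by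
      have := (hli s).integrable_smul_left_of_hasCompactSupport hq.continuous hqc
      simpa only [smul_eq_mul, mul_comm] using this
    have e2 : ∀ s, Integrable fun x => soninePrimitive g (s - x) * deriv q x := fun s =>
      ((hc.comp (by fun_prop : Continuous fun x : ℝ => s - x)).mul hq1).integrable_of_hasCompactSupport
        hqc.deriv.mul_left
    have f1 := fun s => integral_soninePrimitive_mul_deriv h0 hg hq hqc s
    have e10 := e1 0
    have e20 := e2 0
    have f10 := f1 0
    simp only [zero_sub] at e10 e20 f10
    simp only [hr, kernelIncrement, sub_mul]
    rw [integral_sub (e1 t) e10, integral_sub (e2 t) e20, f1, f10]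

theorem rightDerivative_indicator_ae_eq (h0 : ∀ x, x ≤ 0 → g x = 0)
    (hg : ∀ T, 0 < T → IntegrableOn g (Ioo 0 T) volume) {t : ℝ} (ht : 0 ≤ t) :
    rightDerivative g ((Ico 0 t).indicator 1) =ᵐ[volume] kernelIncrement g t := by
  have H : ∃ h, IsRightDerivative g ((Ico 0 t).indicator 1) h :=
    ⟨_, isRightDerivative_kernelIncrement h0 hg ht⟩
  rw [rightDerivative, dif_pos H]
  exact H.choose_spec.ae_eq (isRightDerivative_kernelIncrement h0 hg ht)

end Primitive

/-! ### The Lévy tail and the Sonine primitive as `L²` kernels. -/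

section LevyTail

variable {νbar : ℝ → ℝ}

theorem IsCompleteLevyDensity.nonneg (hν : IsCompleteLevyDensity νbar) {x : ℝ} (hx : 0 < x) :
    0 ≤ νbar x := by
  simpa using hν.1.2 0 x hx

theorem IsCompleteLevyDensity.aestronglyMeasurable (hν : IsCompleteLevyDensity νbar) :
    AEStronglyMeasurable νbar (volume.restrict (Ioi 0)) :=
  hν.1.1.continuousOn.aestronglyMeasurable measurableSet_Ioi

theorem IsCompleteLevyDensity.integrableOn_Ioi (hν : IsCompleteLevyDensity νbar) {x : ℝ}
    (hx : 0 < x) : IntegrableOn νbar (Ioi x) := by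
  have hsub : Ioi x ⊆ Ioi 0 := Ioi_subset_Ioi hx.le
  have hm : 0 < min x 1 := lt_min hx one_pos
  refine ((hν.2.mono_set hsub).const_mul (min x 1)⁻¹).mono'
    (hν.aestronglyMeasurable.mono_measure (Measure.restrict_mono hsub le_rfl)) ?_
  filter_upwards [ae_restrict_mem measurableSet_Ioi] with s hs
  have h1 : min x 1 ≤ min s 1 := min_le_min_right _ (le_of_lt hs)
  have h2 := hν.nonneg (hx.trans hs)
  rw [Real.norm_of_nonneg h2, ← mul_assoc]
  refine le_mul_of_one_le_left h2 ?_
  rw [inv_mul_eq_div, one_le_div hm]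
  exact h1

theorem levyTail_of_nonpos (νbar : ℝ → ℝ) {x : ℝ} (hx : x ≤ 0) : levyTail νbar x = 0 :=
  if_neg (not_lt.2 hx)

theorem levyTail_of_pos (νbar : ℝ → ℝ) {x : ℝ} (hx : 0 < x) :
    levyTail νbar x = ∫ z in Ioi x, νbar z := if_pos hx

theorem IsCompleteLevyDensity.levyTail_nonneg (hν : IsCompleteLevyDensity νbar) (x : ℝ) :
    0 ≤ levyTail νbar x := by
  rcases le_or_gt x 0 with hx | hx
  · rw [levyTail_of_nonpos _ hx]
  · rw [levyTail_of_pos _ hx]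
    exact setIntegral_nonneg measurableSet_Ioi fun z hz => hν.nonneg (hx.trans hz)

theorem IsCompleteLevyDensity.levyTail_sub (hν : IsCompleteLevyDensity νbar) {x y : ℝ}
    (hx : 0 < x) (hxy : x ≤ y) :
    levyTail νbar x - levyTail νbar y = ∫ z in Ioc x y, νbar z := by
  rw [levyTail_of_pos _ hx, levyTail_of_pos _ (hx.trans_le hxy),
    ← setIntegral_sdiff measurableSet_Ioi (hν.integrableOn_Ioi hx) (Ioi_subset_Ioi hxy),
    Ioi_sdiff_Ioi]

theorem IsCompleteLevyDensity.levyTail_antitoneOn (hν : IsCompleteLevyDensity νbar) :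
    AntitoneOn (levyTail νbar) (Ioi 0) := by
  intro x hx y hy hxy
  rw [← sub_nonneg, hν.levyTail_sub hx hxy]
  exact setIntegral_nonneg measurableSet_Ioc fun z hz => hν.nonneg (lt_trans hx hz.1)

theorem IsCompleteLevyDensity.aemeasurable_levyTail (hν : IsCompleteLevyDensity νbar) :
    AEMeasurable (levyTail νbar) (volume.restrict (Ioi 0)) :=
  aemeasurable_restrict_of_antitoneOn measurableSet_Ioi hν.levyTail_antitoneOn

/-- Near `0` square integrability is assumed; on `[1, R]` the tail is bounded by its value at `1`.
Its increments are integrals of `νbar`, up to sign. -/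
theorem IsCompleteLevyDensity.isL2Kernel (hν : IsCompleteLevyDensity νbar) (hA : CondA νbar) :
    IsL2Kernel (levyTail νbar) νbar where
  zero x hx := levyTail_of_nonpos νbar hx
  memLp_Ioo R := by
    have h1 : MemLp (levyTail νbar) 2 (volume.restrict (Icc 1 R)) := by
      refine MemLp.of_bound (hν.aemeasurable_levyTail.mono_measure
        (Measure.restrict_mono ?_ le_rfl)).aestronglyMeasurable (levyTail νbar 1) ?_
      · exact fun x hx => one_pos.trans_le hx.1
      · filter_upwards [ae_restrict_mem measurableSet_Icc] with x hx
        rw [Real.norm_of_nonneg (hν.levyTail_nonneg x)]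
        exact hν.levyTail_antitoneOn (mem_Ioi.2 one_pos) (mem_Ioi.2 (one_pos.trans_le hx.1)) hx.1
    rw [← memLp_indicator_iff_restrict measurableSet_Ioo] at *
    have h2 := (memLp_indicator_iff_restrict (μ := volume) measurableSet_Ioo).2 hA.2.1
    have h3 := (memLp_indicator_iff_restrict (μ := volume) measurableSet_Icc).2 h1
    rw [show (Ioo 0 R).indicator (levyTail νbar) = (Ioo 0 R).indicator
        ((Ioo 0 1).indicator (levyTail νbar) + (Icc 1 R).indicator (levyTail νbar)) from ?_]
    · exact (h2.add h3).indicator measurableSet_Ioo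
    · ext x
      by_cases hx : x ∈ Ioo 0 R
      · rw [indicator_of_mem hx, indicator_of_mem hx, Pi.add_apply]
        rcases lt_or_ge x 1 with h | h
        · rw [indicator_of_mem (s := Ioo 0 1) ⟨hx.1, h⟩,
            indicator_of_notMem (s := Icc 1 R) (fun h' => h.not_ge h'.1), add_zero]
        · rw [indicator_of_notMem (s := Ioo 0 1) (fun h' => h.not_gt h'.2),
            indicator_of_mem (s := Icc 1 R) ⟨h, hx.2.le⟩,
            zero_add]
      · rw [indicator_of_notMem hx, indicator_of_notMem hx]
  memLp_deriv := hA.1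
  enorm_sub_le y h hy hh := by
    rw [← enorm_neg, neg_sub, hν.levyTail_sub (by linarith) (by linarith)]
    exact enorm_integral_le_lintegral_enorm _

end LevyTail

theorem IsSonineKernel.isL2Kernel {ν κ : ℝ → ℝ} (hκ : IsSonineKernel ν κ) (hB : CondB κ) :
    IsL2Kernel (soninePrimitive κ) κ where
  zero x hx := soninePrimitive_of_nonpos κ hx
  memLp_Ioo R := by
    rcases le_or_gt R 0 with hR | hR
    · rw [Ioo_eq_empty (not_lt.2 hR), Measure.restrict_empty]
      exact memLp_measure_zero
    · exact (hB R hR).2.2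
  memLp_deriv := (hB 1 one_pos).2.1
  enorm_sub_le y h hy hh := by
    rw [soninePrimitive_sub hκ.2.1 (by linarith), inter_eq_left.2 (fun z hz => by
      rw [mem_Ioi]; linarith [hz.1]), integral_Ico_eq_integral_Ioo, ← integral_Ioc_eq_integral_Ioo]
    exact enorm_integral_le_lintegral_enorm _

theorem IsL2Kernel.integrableOn_Ioo {k q : ℝ → ℝ} (hk : IsL2Kernel k q) (T : ℝ) :
    IntegrableOn k (Ioo 0 T) volume :=
  memLp_one_iff_integrable.1 ((hk.memLp_Ioo T).mono_exponent (by norm_num))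

end BGM

namespace BGM

open ENNReal NNReal FourierTransform

/-! ### Plancherel identity and spectral lower bounds -/

/-- Both transforms agree as tempered distributions: against a test function, each moves the Fourier
transform onto the test function. -/
theorem fourier_toLp_ae_eq {f : ℝ → ℂ} (h1 : Integrable f) (h2 : MemLp f 2 volume) :
    (𝓕 (h2.toLp f) : Lp ℂ 2 (volume : Measure ℝ)) =ᵐ[volume] 𝓕 f := by
  have hbdd : Continuous (𝓕 f) :=
    VectorFourier.fourierIntegral_continuous Real.continuous_fourierChar
      (innerSL ℝ).continuous₂ h1
  refine ae_eq_of_integral_contDiff_smul_eq ((Lp.memLp _).locallyIntegrable (by norm_num))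
    hbdd.locallyIntegrable fun g hg hgc => ?_
  have hgc' : HasCompactSupport fun x => (g x : ℂ) := hgc.comp_left (g := fun x : ℝ => (x : ℂ)) rfl
  have hg' : ContDiff ℝ ∞ fun x => (g x : ℂ) := Complex.ofRealCLM.contDiff.comp hg
  set G : 𝓢(ℝ, ℂ) := hgc'.toSchwartzMap hg' with hG
  have hGx : ∀ x, G x = (g x : ℂ) := fun x => rfl
  have e1 := congrArg (fun T : TemperedDistribution ℝ ℂ => T G)
    (Lp.fourier_toTemperedDistribution_eq (h2.toLp f))
  simp only [TemperedDistribution.fourier_apply, Lp.toTemperedDistribution_apply] at e1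
  have e2 : ∫ x, (𝓕 G) x • (h2.toLp f : Lp ℂ 2 (volume : Measure ℝ)) x = ∫ x, (𝓕 G) x • f x := by
    refine integral_congr_ae ?_
    filter_upwards [h2.coeFn_toLp] with x hx
    rw [hx]
  have e3 : ∫ x, (𝓕 G) x • f x = ∫ x, G x • (𝓕 f) x := by
    simpa using! VectorFourier.integral_fourierIntegral_smul_eq_flip (L := innerₗ ℝ)
      Real.continuous_fourierChar continuous_inner G.integrable h1
  rw [e2, e3] at e1
  simp only [hGx, smul_eq_mul] at e1
  simp only [Complex.real_smul]
  exact e1.symm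

theorem lintegral_enorm_fourier_sq {f : ℝ → ℂ} (h1 : Integrable f) (h2 : MemLp f 2 volume) :
    ∫⁻ w, ‖𝓕 f w‖ₑ ^ 2 = ∫⁻ y, ‖f y‖ₑ ^ 2 := by
  have e : ∀ g : ℝ → ℂ, ∫⁻ w, ‖g w‖ₑ ^ 2 = eLpNorm g 2 volume ^ 2 := fun g => by
    rw [eLpNorm_eq_lintegral_rpow_enorm_toReal (by norm_num) (by norm_num), ← ENNReal.rpow_natCast,
      ← ENNReal.rpow_mul]
    simp
  rw [e, e, ← eLpNorm_congr_ae (fourier_toLp_ae_eq h1 h2), ← eLpNorm_congr_ae h2.coeFn_toLp,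
    ← Lp.enorm_def, ← Lp.enorm_def, ← ofReal_norm, ← ofReal_norm, Lp.norm_fourier_eq]

/-- Damping by `e^(-εy)` makes `h` integrable without increasing its `L²` norm, and the Fourier
transform of the damped function is `H` on the line of real part `ε`. Plancherel for each `ε` and
Fatou as `ε → 0` give the bound, with no need for `h` to be integrable. -/
theorem lintegral_enorm_laplace_limit_sq_le {h : ℝ → ℝ} (h0 : ∀ y, y ≤ 0 → h y = 0)
    (hh : MemLp h 2 volume) {H : ℂ → ℂ} {B : ℝ → ℝ≥0∞}
    (hH : ∀ z : ℂ, 0 < z.re → ∫ y : ℝ, Complex.exp (-(z * y)) * h y = H z)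
    (hB : ∀ᵐ w, B w ≤ liminf (fun n : ℕ =>
      ‖H (((1 / ((n : ℝ) + 1) : ℝ) : ℂ) + Complex.I * ((2 * Real.pi * w : ℝ) : ℂ))‖ₑ ^ 2) atTop) :
    ∫⁻ w, B w ≤ ∫⁻ y, ‖h y‖ₑ ^ 2 := by
  set ε : ℕ → ℝ := fun n => 1 / ((n : ℝ) + 1) with hε
  have hε0 : ∀ n, 0 < ε n := fun n => by positivity
  set f : ℕ → ℝ → ℂ := fun n y => (Real.exp (-(ε n * y)) * h y : ℝ) with hf
  have hhm := hh.1
  have hfm : ∀ n, AEStronglyMeasurable (f n) volume := fun n =>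
    Complex.continuous_ofReal.comp_aestronglyMeasurable
      ((by fun_prop : Continuous fun y : ℝ => Real.exp (-(ε n * y))).aestronglyMeasurable.mul hhm)
  have hfb : ∀ n y, ‖f n y‖ ≤ ‖h y‖ := by
    intro n y
    rw [hf, Complex.norm_real, norm_mul, Real.norm_of_nonneg (Real.exp_pos _).le]
    rcases le_or_gt y 0 with hy | hy
    · simp [h0 y hy]
    · refine mul_le_of_le_one_left (norm_nonneg _) (Real.exp_le_one_iff.2 ?_)
      have := mul_pos (hε0 n) hy
      linarith
  have hf2 : ∀ n, MemLp (f n) 2 volume := fun n =>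
    hh.mono (hfm n) (Eventually.of_forall (hfb n))
  have hf1 : ∀ n, Integrable (f n) := by
    intro n
    have hexp : MemLp ((Ioi (0 : ℝ)).indicator fun y => Real.exp (-(ε n * y))) 2 volume := by
      rw [memLp_indicator_iff_restrict measurableSet_Ioi, memLp_two_iff_integrable_sq
        (by fun_prop : Continuous fun y : ℝ => Real.exp (-(ε n * y))).aestronglyMeasurable]
      have := integrableOn_exp_mul_Ioi (a := -(2 * ε n)) (by linarith [hε0 n]) 0
      refine this.congr_fun (fun y _ => ?_) measurableSet_Ioi
      simp only
      rw [← Real.exp_nat_mul]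
      congr 1
      push_cast
      ring
    have := (hexp.integrable_mul hh).ofReal (𝕜 := ℂ)
    refine this.congr (Eventually.of_forall fun y => ?_)
    simp only [hf, Pi.mul_apply]
    rcases le_or_gt y 0 with hy | hy
    · simp [h0 y hy]
    · rw [indicator_of_mem (by exact hy)]
      rfl
  have hFf : ∀ n w, 𝓕 (f n) w = H ((ε n : ℂ) + Complex.I * ((2 * Real.pi * w : ℝ) : ℂ)) := by
    intro n w
    rw [← hH _ (by simp [hε0 n]), Real.fourier_real_eq_integral_exp_smul]
    congr 1
    ext y
    simp only [hf, smul_eq_mul]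
    push_cast
    rw [← mul_assoc, ← Complex.exp_add]
    congr 2
    ring
  calc ∫⁻ w, B w ≤ ∫⁻ w, liminf (fun n : ℕ => ‖𝓕 (f n) w‖ₑ ^ 2) atTop := by
        refine lintegral_mono_ae ?_
        filter_upwards [hB] with w hw
        simpa only [hFf] using hw
    _ ≤ liminf (fun n : ℕ => ∫⁻ w, ‖𝓕 (f n) w‖ₑ ^ 2) atTop := by
        refine lintegral_liminf_le fun n => ?_
        have : Continuous (𝓕 (f n)) :=
          VectorFourier.fourierIntegral_continuous Real.continuous_fourierChar
            (innerSL ℝ).continuous₂ (hf1 n)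
        exact (this.measurable.enorm).pow_const 2
    _ ≤ _ := by
        refine liminf_le_of_frequently_le' (Frequently.of_forall fun n => ?_)
        rw [lintegral_enorm_fourier_sq (hf1 n) (hf2 n)]
        refine lintegral_mono fun y => ?_
        gcongr
        exact enorm_le_iff_norm_le.2 (hfb n y)

/-- Were the integrand not integrable, its Bochner integral would be `0`, against the positive lower
bound. -/
theorem LowerBound.integrable {A : ℝ → ℝ} {C β : ℝ} (h : LowerBound A C β) (hC : 0 < C) {a : ℝ}
    (ha : 0 < a) : Integrable fun x : ℝ => A (x * a) / x ^ 2 * (1 - Real.cos x) := by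
  by_contra hn
  have h1 := h a ha
  rw [integral_undef hn] at h1
  have : 0 < C * a ^ β := by positivity
  linarith

/-- The reflected increment `k(y) - k(y - t)` lives on `(0, ∞)` and has Laplace transform `(1 -
e^(-zt)) K(z)`. At `z = iξ` the first factor has squared modulus `2 - 2 cos(tξ)`. Substituting `ξ =
2πw` and then `x = tξ` produces the spectral integral at `a = t⁻¹`. -/
theorem IsL2Kernel.le_integral_sq_kernelIncrement {k q : ℝ → ℝ} (hk : IsL2Kernel k q) {K : ℂ → ℂ}
    {A : ℝ → ℝ} {C β : ℝ}
    (hKi : ∀ z : ℂ, 0 < z.re → Integrable fun y : ℝ => Complex.exp (-(z * y)) * (k y : ℂ))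
    (hK : ∀ z : ℂ, 0 < z.re → ∫ y : ℝ, Complex.exp (-(z * y)) * k y = K z)
    (hlim : ∀ ξ : ℝ, ξ ≠ 0 → A ξ ≠ 0 → ∃ K₀ : ℂ, Tendsto (fun n : ℕ =>
      K (((1 / ((n : ℝ) + 1) : ℝ) : ℂ) + Complex.I * (ξ : ℂ))) atTop (𝓝 K₀) ∧
        ‖K₀‖ ^ 2 = A ξ / ξ ^ 2)
    (hA : ∀ ξ, 0 ≤ A ξ) (hLB : LowerBound A C β) (hC : 0 < C) {t : ℝ} (ht : 0 < t) :
    C / Real.pi * t ^ (1 - β) ≤ ∫ x, kernelIncrement k t x ^ 2 := by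
  have hinc := hk.memLp_kernelIncrement ht.le
  set h : ℝ → ℝ := fun y => kernelIncrement k t (t - y) with hh
  have hhe : ∀ y, h y = k y - k (y - t) := fun y => by simp [hh, kernelIncrement]
  have hmp := Measure.measurePreserving_sub_left (volume : Measure ℝ) t
  have hL2 : MemLp h 2 volume := hinc.comp_measurePreserving hmp
  have hH : ∀ z : ℂ, 0 < z.re →
      ∫ y : ℝ, Complex.exp (-(z * y)) * h y = (1 - Complex.exp (-(z * t))) * K z := by
    intro z hz
    have e : ∀ y : ℝ, Complex.exp (-(z * y)) * (h y : ℂ) = Complex.exp (-(z * y)) * k y -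
        Complex.exp (-(z * t)) * (Complex.exp (-(z * (y - t : ℝ))) * k (y - t)) := by
      intro y
      rw [hhe, ← mul_assoc, ← Complex.exp_add]
      push_cast
      ring_nf
    simp only [e]
    rw [integral_sub (hKi z hz) (((hKi z hz).comp_sub_right t).const_mul _), integral_const_mul,
      integral_sub_right_eq_self (fun y : ℝ => Complex.exp (-(z * y)) * (k y : ℂ)), hK z hz]
    ring
  set F : ℝ → ℝ := fun x => A (x * t⁻¹) / x ^ 2 * (1 - Real.cos x) with hF
  have hF0 : ∀ x, 0 ≤ F x := fun x =>
    mul_nonneg (div_nonneg (hA _) (sq_nonneg _)) (by linarith [Real.cos_le_one x])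
  have hFi : Integrable F := hLB.integrable hC (inv_pos.2 ht)
  have hpt : (0 : ℝ) < 2 * Real.pi * t := by positivity
  have key := lintegral_enorm_laplace_limit_sq_le (h := h)
    (B := fun w => ENNReal.ofReal (2 * t ^ 2 * F (2 * Real.pi * t * w)))
    (fun y hy => by rw [hhe, hk.zero y hy, hk.zero _ (by linarith), sub_zero]) hL2 hH (by
      filter_upwards [compl_mem_ae_iff.2 (measure_singleton (μ := volume) (0 : ℝ))] with w hw
      have hw0 : w ≠ 0 := hw
      set ξ : ℝ := 2 * Real.pi * w with hξ
      have hξ0 : ξ ≠ 0 := mul_ne_zero (by positivity) hw0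
      have hB : 2 * t ^ 2 * F (2 * Real.pi * t * w) =
          (2 - 2 * Real.cos (t * ξ)) * (A ξ / ξ ^ 2) := by
        have e1 : 2 * Real.pi * t * w * t⁻¹ = ξ := by
          rw [hξ]
          field_simp
        have e2 : 2 * Real.pi * t * w = t * ξ := by
          rw [hξ]
          ring
        simp only [hF]
        rw [e1, e2]
        field_simp
      rw [hB]
      clear_value ξ
      -- In the integral case `A ξ` is `0` by convention at a zero of `φ(iξ)`, where no boundary
      -- value is available; the bound is then trivial.
      by_cases hAξ : A ξ = 0
      · simp [hAξ]
      obtain ⟨K₀, hK₀, hn⟩ := hlim ξ hξ0 hAξ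
      have hε : Tendsto (fun n : ℕ => (((1 / ((n : ℝ) + 1) : ℝ) : ℂ) + Complex.I * (ξ : ℂ))) atTop
          (𝓝 (((0 : ℝ) : ℂ) + Complex.I * (ξ : ℂ))) :=
        ((Complex.continuous_ofReal.tendsto 0).comp
          tendsto_one_div_add_atTop_nhds_zero_nat).add_const _
      have hc : Continuous fun z : ℂ => 1 - Complex.exp (-(z * t)) := by fun_prop
      have hlim2 := ((ENNReal.continuous_pow 2).tendsto _).comp
        (((hc.tendsto _).comp hε).mul hK₀).enorm
      refine le_trans (le_of_eq ?_) hlim2.liminf_eq.ge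
      rw [enorm_mul, mul_pow, ← ofReal_norm, ← ofReal_norm, ← ENNReal.ofReal_pow (norm_nonneg _),
        ← ENNReal.ofReal_pow (norm_nonneg _), hn, ← ENNReal.ofReal_mul (by positivity)]
      congr 2
      rw [← Complex.normSq_eq_norm_sq]
      have e3 : -((((0 : ℝ) : ℂ) + Complex.I * (ξ : ℂ)) * (t : ℂ)) =
          ((-(t * ξ) : ℝ) : ℂ) * Complex.I := by
        push_cast
        ring
      rw [e3, Complex.normSq_apply]
      simp only [Complex.sub_re, Complex.sub_im, Complex.one_re, Complex.one_im,
        Complex.exp_ofReal_mul_I_re, Complex.exp_ofReal_mul_I_im, Real.cos_neg, Real.sin_neg]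
      nlinarith [Real.sin_sq_add_cos_sq (t * ξ)])
  have hFi' : Integrable fun w => 2 * t ^ 2 * F (2 * Real.pi * t * w) :=
    (hFi.comp_mul_left' hpt.ne').const_mul _
  rw [← ofReal_integral_eq_lintegral_ofReal hFi' (Eventually.of_forall fun w =>
    mul_nonneg (by positivity) (hF0 _))] at key
  have hr : ∫⁻ y, ‖h y‖ₑ ^ 2 = ENNReal.ofReal (∫ x, kernelIncrement k t x ^ 2) := by
    rw [← integral_sub_left_eq_self (fun x => kernelIncrement k t x ^ 2) volume t,
      ofReal_integral_eq_lintegral_ofReal hL2.integrable_sq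
        (Eventually.of_forall fun x => sq_nonneg _)]
    refine lintegral_congr fun y => ?_
    rw [← ofReal_norm, ← ENNReal.ofReal_pow (norm_nonneg _), Real.norm_eq_abs, sq_abs]
  rw [hr, ENNReal.ofReal_le_ofReal_iff (integral_nonneg fun x => sq_nonneg _)] at key
  refine le_trans ?_ key
  rw [integral_const_mul, Measure.integral_comp_mul_left, abs_of_pos (inv_pos.2 hpt), smul_eq_mul]
  have h1 := hLB t⁻¹ (inv_pos.2 ht)
  have h2 : C / Real.pi * t ^ (1 - β) = 2 * t ^ 2 * ((2 * Real.pi * t)⁻¹ * (C * t⁻¹ ^ β)) := by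
    rw [Real.rpow_sub ht, Real.rpow_one, Real.inv_rpow ht.le]
    have := Real.pi_pos
    field_simp
  rw [h2]
  gcongr

end BGM

namespace BGM

open ENNReal NNReal

/-! ### Laplace transforms -/

theorem norm_exp_neg_mul (z : ℂ) (y : ℝ) :
    ‖Complex.exp (-(z * y))‖ = Real.exp (-(z.re * y)) := by
  rw [Complex.norm_exp]
  simp

theorem norm_one_sub_exp_neg_le {w : ℂ} (hw : 0 ≤ w.re) :
    ‖1 - Complex.exp (-w)‖ ≤ 2 ∧ ‖1 - Complex.exp (-w)‖ ≤ 2 * ‖w‖ := by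
  have h2 : ‖1 - Complex.exp (-w)‖ ≤ 2 := by
    refine (norm_sub_le _ _).trans ?_
    have : ‖Complex.exp (-w)‖ ≤ 1 := by
      rw [Complex.norm_exp, Complex.neg_re]
      exact Real.exp_le_one_iff.2 (by linarith)
    rw [norm_one]
    linarith
  refine ⟨h2, ?_⟩
  rcases le_or_gt ‖w‖ 1 with h | h
  · have := Complex.norm_exp_sub_one_le (x := -w) (by rwa [norm_neg])
    rwa [norm_sub_rev, norm_neg] at this
  · linarith

theorem IsCompleteLevyDensity.norm_bernstein_integrand_le {νbar : ℝ → ℝ}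
    (hν : IsCompleteLevyDensity νbar) {z : ℂ} (hz : 0 ≤ z.re) {s : ℝ} (hs : 0 < s) :
    ‖(1 - Complex.exp (-((s : ℂ) * z))) * (νbar s : ℂ)‖ ≤
      2 * max ‖z‖ 1 * (min s 1 * νbar s) := by
  have hν0 := hν.nonneg hs
  have h1 := norm_one_sub_exp_neg_le (w := (s : ℂ) * z) (by
    rw [Complex.re_ofReal_mul]
    positivity)
  rw [norm_mul (s : ℂ), Complex.norm_real, Real.norm_of_nonneg hs.le] at h1
  rw [norm_mul, Complex.norm_real, Real.norm_of_nonneg hν0, ← mul_assoc]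
  gcongr
  have hm1 : ‖z‖ ≤ max ‖z‖ 1 := le_max_left _ _
  have hm2 : 1 ≤ max ‖z‖ 1 := le_max_right _ _
  rcases le_total s 1 with h | h
  · rw [min_eq_left h]
    nlinarith [h1.2]
  · rw [min_eq_right h]
    linarith [h1.1]

/-- Continuity up to the imaginary axis, by domination: on bounded subsets of the closed half-plane
the integrand is at most a constant times `min s 1 * νbar s`. -/
theorem IsCompleteLevyDensity.tendsto_bernsteinExt {νbar : ℝ → ℝ}
    (hν : IsCompleteLevyDensity νbar) (ξ : ℝ) :
    Tendsto (fun n : ℕ => bernsteinExt νbar (((1 / ((n : ℝ) + 1) : ℝ) : ℂ) + Complex.I * (ξ : ℂ)))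
      atTop (𝓝 (bernsteinExt νbar (Complex.I * ξ))) := by
  have hlim : Tendsto (fun n : ℕ => (((1 / ((n : ℝ) + 1) : ℝ) : ℂ) + Complex.I * (ξ : ℂ))) atTop
      (𝓝 (Complex.I * (ξ : ℂ))) := by
    have := ((Complex.continuous_ofReal.tendsto 0).comp
      (tendsto_one_div_add_atTop_nhds_zero_nat (𝕜 := ℝ))).add_const (Complex.I * (ξ : ℂ))
    simpa only [Complex.ofReal_zero, zero_add] using! this
  refine tendsto_integral_of_dominated_convergence
    (fun s => 2 * (2 + |ξ|) * (min s 1 * νbar s)) (fun n => ?_) (hν.2.const_mul _) (fun n => ?_) ?_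
  · exact (by fun_prop : Continuous fun s : ℝ => 1 - Complex.exp (-((s : ℂ) *
      (((1 / ((n : ℝ) + 1) : ℝ) : ℂ) + Complex.I * (ξ : ℂ))))).aestronglyMeasurable.mul
      (Complex.continuous_ofReal.comp_aestronglyMeasurable hν.aestronglyMeasurable)
  · filter_upwards [ae_restrict_mem measurableSet_Ioi] with s hs
    refine (hν.norm_bernstein_integrand_le ?_ hs).trans ?_
    · simp only [Complex.add_re, Complex.ofReal_re, Complex.I_mul_re, Complex.ofReal_im, neg_zero,
        add_zero]
      positivity
    · have h1 : ‖((1 / ((n : ℝ) + 1) : ℝ) : ℂ) + Complex.I * (ξ : ℂ)‖ ≤ 2 + |ξ| := by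
        refine (norm_add_le _ _).trans ?_
        rw [norm_mul, Complex.norm_I, one_mul, Complex.norm_real, Complex.norm_real,
          Real.norm_of_nonneg (by positivity), Real.norm_eq_abs]
        have : 1 / ((n : ℝ) + 1) ≤ 1 := by
          rw [div_le_one (by positivity)]
          linarith [(Nat.cast_nonneg n : (0 : ℝ) ≤ n)]
        linarith
      have h2 : max ‖((1 / ((n : ℝ) + 1) : ℝ) : ℂ) + Complex.I * (ξ : ℂ)‖ 1 ≤ 2 + |ξ| :=
        max_le h1 (by linarith [abs_nonneg ξ])
      have h3 : 0 ≤ min s 1 * νbar s :=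
        mul_nonneg (le_min (le_of_lt hs) zero_le_one) (hν.nonneg hs)
      gcongr
  · refine Eventually.of_forall fun s => ?_
    have hc : Continuous fun z : ℂ => (1 - Complex.exp (-((s : ℂ) * z))) * (νbar s : ℂ) := by
      fun_prop
    exact (hc.tendsto _).comp hlim

theorem integral_Ioo_exp_neg_mul {z : ℂ} (hz : z ≠ 0) {s : ℝ} (hs : 0 ≤ s) :
    ∫ y in Ioo 0 s, Complex.exp (-(z * y)) = (1 - Complex.exp (-((s : ℂ) * z))) / z := by
  have h := integral_exp_mul_complex (a := 0) (b := s) (c := -z) (neg_ne_zero.2 hz)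
  rw [intervalIntegral.integral_of_le hs, integral_Ioc_eq_integral_Ioo] at h
  simp only [neg_mul] at h
  rw [h]
  simp only [Complex.ofReal_zero, mul_zero, neg_zero, Complex.exp_zero]
  rw [mul_comm z, div_neg, ← neg_div, neg_sub]

/-- Fubini over `0 < y < s`: the inner integral of `e^(-zy)` over `(0, s)` is `(1 - e^(-sz))/z`. In
absolute value it is at most both `s` and `1 / z.re`, hence at most `max 1 z.re⁻¹ * min s 1`. -/
theorem IsCompleteLevyDensity.laplace_levyTail {νbar : ℝ → ℝ} (hν : IsCompleteLevyDensity νbar)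
    {z : ℂ} (hz : 0 < z.re) :
    (Integrable fun y : ℝ => Complex.exp (-(z * y)) * (levyTail νbar y : ℂ)) ∧
      ∫ y : ℝ, Complex.exp (-(z * y)) * levyTail νbar y = bernsteinExt νbar z / z := by
  have hz0 : z ≠ 0 := fun h => by simp [h] at hz
  set S : Set (ℝ × ℝ) := {p | 0 < p.1 ∧ p.1 < p.2} with hS
  have hSm : MeasurableSet S := (measurableSet_lt measurable_const measurable_fst).inter
    (measurableSet_lt measurable_fst measurable_snd)
  set ρ : Measure ℝ := volume.restrict (Ioi 0) with hρ
  set G : ℝ × ℝ → ℂ := S.indicator fun p => Complex.exp (-(z * p.1)) * (νbar p.2 : ℂ) with hG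
  have hGm : AEStronglyMeasurable G (volume.prod ρ) := by
    refine AEStronglyMeasurable.indicator (AEStronglyMeasurable.mul ?_ ?_) hSm
    · exact (by fun_prop : Continuous fun p : ℝ × ℝ =>
        Complex.exp (-(z * p.1))).aestronglyMeasurable
    · exact Complex.continuous_ofReal.comp_aestronglyMeasurable hν.aestronglyMeasurable.comp_snd
  have hGy : ∀ s y, G (y, s) =
      (Ioo 0 s).indicator (fun y : ℝ => Complex.exp (-(z * y)) * (νbar s : ℂ)) y := fun s y => rfl
  have hGs : ∀ y, 0 < y → ∀ s, G (y, s) =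
      (Ioi y).indicator (fun s : ℝ => Complex.exp (-(z * y)) * (νbar s : ℂ)) s := by
    intro y hy s
    simp only [hG, hS, indicator, mem_ofPred_eq, mem_Ioi, hy, true_and]
  have hexp : ∀ s : ℝ, IntegrableOn (fun y : ℝ => Complex.exp (-(z * y))) (Ioo 0 s) := fun s =>
    ((by fun_prop : Continuous fun y : ℝ => Complex.exp (-(z * y))).integrableOn_Icc).mono_set
      Ioo_subset_Icc_self
  have hGi : Integrable G (volume.prod ρ) := by
    rw [integrable_prod_iff' hGm]
    refine ⟨Eventually.of_forall fun s => ?_, ?_⟩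
    · simp only [hGy]
      rw [integrable_indicator_iff measurableSet_Ioo]
      exact (hexp s).mul_const _
    · refine (hν.2.const_mul (max 1 z.re⁻¹)).mono' hGm.norm.prod_swap.integral_prod_right' ?_
      filter_upwards [ae_restrict_mem measurableSet_Ioi] with s hs
      rw [mem_Ioi] at hs
      have hν0 := hν.nonneg hs
      rw [Real.norm_of_nonneg (integral_nonneg fun y => norm_nonneg _)]
      simp only [hGy, norm_indicator_eq_indicator_norm]
      rw [integral_indicator measurableSet_Ioo]
      simp only [norm_mul, Complex.norm_real, Real.norm_of_nonneg hν0, norm_exp_neg_mul]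
      rw [integral_mul_const, ← mul_assoc]
      gcongr
      have hb1 : ∫ y in Ioo 0 s, Real.exp (-(z.re * y)) ≤ s := by
        calc ∫ y in Ioo 0 s, Real.exp (-(z.re * y)) ≤ ∫ y in Ioo 0 s, (1 : ℝ) := by
              refine setIntegral_mono_on ?_ (by simp) measurableSet_Ioo fun y hy => ?_
              · exact ((by fun_prop : Continuous fun y : ℝ =>
                  Real.exp (-(z.re * y))).integrableOn_Icc).mono_set Ioo_subset_Icc_self
              · exact Real.exp_le_one_iff.2 (by nlinarith [mul_pos hz hy.1])
          _ = s := by simp [hs.le]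
      have hb2 : ∫ y in Ioo 0 s, Real.exp (-(z.re * y)) ≤ z.re⁻¹ := by
        have hi := integrableOn_exp_mul_Ioi (a := -z.re) (by linarith) 0
        have he := integral_exp_mul_Ioi (a := -z.re) (by linarith) 0
        simp only [neg_mul] at hi he
        calc ∫ y in Ioo 0 s, Real.exp (-(z.re * y)) ≤ ∫ y in Ioi 0, Real.exp (-(z.re * y)) :=
              setIntegral_mono_set hi (Eventually.of_forall fun y => (Real.exp_pos _).le)
                (Ioo_subset_Ioi_self.eventuallyLE)
          _ = z.re⁻¹ := by
              rw [he]
              simp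
      have hm1 : 1 ≤ max 1 z.re⁻¹ := le_max_left _ _
      have hm2 : z.re⁻¹ ≤ max 1 z.re⁻¹ := le_max_right _ _
      rcases le_total s 1 with h | h
      · rw [min_eq_left h]
        nlinarith
      · rw [min_eq_right h]
        linarith
  have hin : ∀ y : ℝ, ∫ s, G (y, s) ∂ρ = Complex.exp (-(z * y)) * levyTail νbar y := by
    intro y
    rcases le_or_gt y 0 with hy | hy
    · have : ∀ s, G (y, s) = 0 := fun s => by
        rw [hGy, indicator_of_notMem fun h => hy.not_gt h.1]
      simp [this, levyTail_of_nonpos _ hy]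
    · simp only [hGs y hy]
      rw [integral_indicator measurableSet_Ioi, hρ, Measure.restrict_restrict measurableSet_Ioi,
        inter_eq_left.2 (Ioi_subset_Ioi hy.le), integral_const_mul, integral_complex_ofReal,
        levyTail_of_pos _ hy]
  have hint := hGi.integral_prod_left
  simp only [hin] at hint
  refine ⟨hint, ?_⟩
  calc ∫ y : ℝ, Complex.exp (-(z * y)) * levyTail νbar y = ∫ y, ∫ s, G (y, s) ∂ρ := by
        simp only [hin]
    _ = ∫ s, (∫ y, G (y, s)) ∂ρ := integral_integral_swap (f := fun y s => G (y, s)) hGi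
    _ = ∫ s : ℝ in Ioi 0, ((1 - Complex.exp (-((s : ℂ) * z))) * (νbar s : ℂ)) / z := by
        refine setIntegral_congr_fun measurableSet_Ioi fun s hs => ?_
        simp only [hGy]
        rw [integral_indicator measurableSet_Ioo, integral_mul_const,
          integral_Ioo_exp_neg_mul hz0 (le_of_lt hs)]
        ring
    _ = _ := by rw [integral_div, bernsteinExt]

theorem integrable_exp_indicator_Ioi {z : ℂ} (hz : 0 < z.re) :
    Integrable fun y : ℝ => Complex.exp (-(z * y)) * (((Ioi (0 : ℝ)).indicator (1 : ℝ → ℝ) y : ℝ) : ℂ) := by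
  have h := integrableOn_exp_mul_complex_Ioi (a := -z) (by simpa using hz) 0
  refine ((integrable_indicator_iff measurableSet_Ioi).2 h).congr (Eventually.of_forall fun y => ?_)
  by_cases hy : y ∈ Ioi (0 : ℝ) <;> simp [hy]

theorem integral_exp_indicator_Ioi {z : ℂ} (hz : 0 < z.re) :
    ∫ y : ℝ, Complex.exp (-(z * y)) * (((Ioi (0 : ℝ)).indicator (1 : ℝ → ℝ) y : ℝ) : ℂ) = 1 / z := by
  have h := integral_exp_mul_complex_Ioi (a := -z) (by simpa using hz) 0
  rw [← integral_indicator measurableSet_Ioi] at h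
  calc _ = ∫ y : ℝ, (Ioi (0 : ℝ)).indicator (fun y : ℝ => Complex.exp (-z * y)) y := by
        congr 1
        ext y
        by_cases hy : y ∈ Ioi (0 : ℝ) <;> simp [hy]
    _ = _ := by
        rw [h]
        simp

/-- The Laplace transform of a convolution product. -/
theorem laplace_convolution {f g c : ℝ → ℝ} {z : ℂ}
    (hf : Integrable fun y : ℝ => Complex.exp (-(z * y)) * (f y : ℂ))
    (hg : Integrable fun y : ℝ => Complex.exp (-(z * y)) * (g y : ℂ))
    (hc : ∀ t, ∫ s, f s * g (t - s) = c t) :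
    (Integrable fun y : ℝ => Complex.exp (-(z * y)) * (c y : ℂ)) ∧
      ∫ y : ℝ, Complex.exp (-(z * y)) * c y =
        (∫ y : ℝ, Complex.exp (-(z * y)) * f y) * ∫ y : ℝ, Complex.exp (-(z * y)) * g y := by
  have e : convolution (fun y : ℝ => Complex.exp (-(z * y)) * (f y : ℂ))
      (fun y : ℝ => Complex.exp (-(z * y)) * (g y : ℂ)) (ContinuousLinearMap.mul ℂ ℂ) volume =
      fun t : ℝ => Complex.exp (-(z * t)) * (c t : ℂ) := by
    ext t
    rw [convolution, ← hc t, ← integral_complex_ofReal, ← integral_const_mul]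
    congr 1
    ext s
    have : Complex.exp (-(z * t)) = Complex.exp (-(z * s)) * Complex.exp (-(z * (t - s : ℝ))) := by
      rw [← Complex.exp_add]
      congr 1
      push_cast
      ring
    rw [this, ContinuousLinearMap.mul_apply']
    push_cast
    ring
  refine ⟨e ▸ hf.integrable_convolution (ContinuousLinearMap.mul ℂ ℂ) hg, ?_⟩
  have := integral_convolution (ContinuousLinearMap.mul ℂ ℂ) (μ := volume) (ν := volume) hf hg
  rw [e] at this
  simpa using this

/-! ### The Laplace transform of the Sonine kernel. -/

namespace IsSonineKernel

variable {νbar κ : ℝ → ℝ}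

theorem aestronglyMeasurable {ν : ℝ → ℝ} (hκ : IsSonineKernel ν κ) :
    AEStronglyMeasurable ((Ioi 0).indicator κ) volume := by
  refine aestronglyMeasurable_of_tendsto_ae atTop (f := fun (n : ℕ) =>
    (Ioo (0 : ℝ) ((n : ℝ) + 1)).indicator κ) (fun n => ?_) (Eventually.of_forall fun x => ?_)
  · exact ((integrable_indicator_iff measurableSet_Ioo).2 (hκ.2.1 _ (by positivity))).1
  · obtain ⟨N, hN⟩ := exists_nat_gt x
    refine tendsto_const_nhds.congr' ?_
    filter_upwards [eventually_ge_atTop N] with n hn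
    have hn' : (N : ℝ) ≤ n := by exact_mod_cast hn
    by_cases hx : 0 < x
    · rw [indicator_of_mem (by exact hx), indicator_of_mem (s := Ioo (0 : ℝ) (n + 1)) ⟨hx, by linarith⟩]
    · rw [indicator_of_notMem (s := Ioi 0) hx,
        indicator_of_notMem (s := Ioo (0 : ℝ) (n + 1)) fun h => hx h.1]

theorem mul_indicator_eq {ν : ℝ → ℝ} (hν : ∀ x, x ≤ 0 → ν x = 0) (t z : ℝ) :
    ν z * (Ioi 0).indicator κ (t - z) = (Ioo 0 t).indicator (fun z => ν z * κ (t - z)) z := by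
  by_cases hz : 0 < z
  · by_cases hzt : z < t
    · rw [indicator_of_mem (by rw [mem_Ioi]; linarith), indicator_of_mem (s := Ioo 0 t) ⟨hz, hzt⟩]
    · rw [indicator_of_notMem (by rw [mem_Ioi]; intro h; exact hzt (by linarith)),
        indicator_of_notMem (s := Ioo 0 t) fun h => hzt h.2, mul_zero]
  · rw [hν z (not_lt.1 hz), indicator_of_notMem (s := Ioo 0 t) fun h => hz h.1, zero_mul]

theorem integral_mul_eq {ν : ℝ → ℝ} (hκ : IsSonineKernel ν κ) (hν : ∀ x, x ≤ 0 → ν x = 0)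
    (t : ℝ) : ∫ z, ν z * (Ioi 0).indicator κ (t - z) = (Ioi (0 : ℝ)).indicator 1 t := by
  simp only [mul_indicator_eq hν]
  rw [integral_indicator measurableSet_Ioo]
  by_cases ht : 0 < t
  · rw [(hκ.2.2 t ht).2, indicator_of_mem (by exact ht), Pi.one_apply]
  · rw [Ioo_eq_empty ht, setIntegral_empty, indicator_of_notMem (by exact ht)]

/-- No growth bound on `κ` is given; it is extracted from the Sonine identity. By Tonelli for
nonnegative functions, the damped masses of `ν` and `κ` multiply to the integral of `e^(-εt)` over
`(0, ∞)`, which is positive and finite. So the mass of `ν` is nonzero and that of `κ` is finite. -/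
theorem integrable_exp_mul (hν : IsCompleteLevyDensity νbar)
    (hκ : IsSonineKernel (levyTail νbar) κ) {z : ℂ} (hz : 0 < z.re) :
    Integrable fun y : ℝ => Complex.exp (-(z * y)) * (((Ioi (0 : ℝ)).indicator κ y : ℝ) : ℂ) := by
  have hκm := hκ.aestronglyMeasurable
  have hν0 := fun x (hx : x ≤ 0) => levyTail_of_nonpos νbar hx
  have hκ0 : ∀ y, 0 ≤ (Ioi 0).indicator κ y := fun y => indicator_nonneg (fun x hx => hκ.1 x hx) y
  set ε := z.re with hε
  have hL := (hν.laplace_levyTail (z := (ε : ℂ)) (by simpa using hz)).1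
  set f : ℝ → ℝ := fun y => Real.exp (-(ε * y)) * levyTail νbar y with hf
  set g : ℝ → ℝ := fun y => Real.exp (-(ε * y)) * (Ioi 0).indicator κ y with hg
  have hfm : AEStronglyMeasurable f volume := by
    have := hL.1.norm
    refine this.congr (Eventually.of_forall fun y => ?_)
    simp only [norm_mul, norm_exp_neg_mul, Complex.ofReal_re, Complex.norm_real,
      Real.norm_of_nonneg (hν.levyTail_nonneg y), hf]
  have hgm : AEStronglyMeasurable g volume :=
    (by fun_prop : Continuous fun y : ℝ => Real.exp (-(ε * y))).aestronglyMeasurable.mul hκm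
  have hf0 : ∀ y, 0 ≤ f y := fun y => mul_nonneg (Real.exp_pos _).le (hν.levyTail_nonneg y)
  have hg0 : ∀ y, 0 ≤ g y := fun y => mul_nonneg (Real.exp_pos _).le (hκ0 y)
  have hprod : AEMeasurable (fun p : ℝ × ℝ => ENNReal.ofReal (f p.2 * g (p.1 - p.2)))
      (volume.prod volume) :=
    (hfm.convolution_integrand (ContinuousLinearMap.mul ℝ ℝ) hgm).aemeasurable.ennreal_ofReal
  have hinner : ∀ t, ∫⁻ s, ENNReal.ofReal (f s * g (t - s)) =
      ENNReal.ofReal ((Ioi (0 : ℝ)).indicator (fun t => Real.exp (-(ε * t))) t) := by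
    intro t
    have e : ∀ s, f s * g (t - s) =
        Real.exp (-(ε * t)) * (levyTail νbar s * (Ioi 0).indicator κ (t - s)) := by
      intro s
      have : Real.exp (-(ε * t)) = Real.exp (-(ε * s)) * Real.exp (-(ε * (t - s))) := by
        rw [← Real.exp_add]
        congr 1
        ring
      rw [this]
      simp only [hf, hg]
      ring
    have hi : Integrable fun s => levyTail νbar s * (Ioi 0).indicator κ (t - s) := by
      simp only [mul_indicator_eq hν0]
      rw [integrable_indicator_iff measurableSet_Ioo]
      by_cases ht : 0 < t
      · exact (hκ.2.2 t ht).1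
      · rw [Ioo_eq_empty ht]
        exact integrableOn_empty
    simp only [e]
    rw [← ofReal_integral_eq_lintegral_ofReal (hi.const_mul _) (Eventually.of_forall fun s =>
      mul_nonneg (Real.exp_pos _).le (mul_nonneg (hν.levyTail_nonneg s) (hκ0 _))),
      integral_const_mul, hκ.integral_mul_eq hν0]
    congr 1
    by_cases ht : t ∈ Ioi (0 : ℝ) <;> simp [ht]
  have hswap : ∫⁻ t, ENNReal.ofReal ((Ioi (0 : ℝ)).indicator (fun t => Real.exp (-(ε * t))) t) =
      (∫⁻ s, ENNReal.ofReal (f s)) * ∫⁻ y, ENNReal.ofReal (g y) := by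
    simp only [← hinner]
    rw [lintegral_lintegral_swap (f := fun t s => ENNReal.ofReal (f s * g (t - s))) hprod]
    simp only [ENNReal.ofReal_mul (hf0 _)]
    rw [← lintegral_mul_const'' _ hfm.aemeasurable.ennreal_ofReal]
    refine lintegral_congr fun s => ?_
    rw [lintegral_const_mul'' _ ?_, lintegral_sub_right_eq_self fun y => ENNReal.ofReal (g y)]
    exact (hgm.comp_measurePreserving (measurePreserving_sub_right volume s)).aemeasurable.ennreal_ofReal
  have hexp : Integrable ((Ioi (0 : ℝ)).indicator fun t => Real.exp (-(ε * t))) := by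
    rw [integrable_indicator_iff measurableSet_Ioi]
    have := integrableOn_exp_mul_Ioi (a := -ε) (by linarith) 0
    simpa only [neg_mul] using this
  have hexp_pos : 0 < ∫ t, (Ioi (0 : ℝ)).indicator (fun t => Real.exp (-(ε * t))) t := by
    have := integral_exp_mul_Ioi (a := -ε) (by linarith) 0
    simp only [neg_mul] at this
    rw [integral_indicator measurableSet_Ioi, this]
    simpa using hz
  rw [← ofReal_integral_eq_lintegral_ofReal hexp (Eventually.of_forall fun t =>
    indicator_nonneg (fun _ _ => (Real.exp_pos _).le) t)] at hswap
  have hfin : ∫⁻ y, ENNReal.ofReal (g y) ≠ ⊤ := by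
    intro htop
    rw [htop] at hswap
    by_cases h0 : ∫⁻ s, ENNReal.ofReal (f s) = 0
    · rw [h0, zero_mul, ENNReal.ofReal_eq_zero] at hswap
      linarith
    · rw [ENNReal.mul_top h0] at hswap
      exact ENNReal.ofReal_ne_top hswap
  have hgi : Integrable g := by
    refine ⟨hgm, ?_⟩
    rw [hasFiniteIntegral_iff_ofReal (Eventually.of_forall hg0)]
    exact hfin.lt_top
  refine hgi.mono' ((by fun_prop : Continuous fun y : ℝ =>
    Complex.exp (-(z * y))).aestronglyMeasurable.mul
      (Complex.continuous_ofReal.comp_aestronglyMeasurable hκm)) (Eventually.of_forall fun y => ?_)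
  rw [norm_mul, norm_exp_neg_mul, Complex.norm_real, Real.norm_of_nonneg (hκ0 y)]

theorem laplace_eq (hν : IsCompleteLevyDensity νbar)
    (hκ : IsSonineKernel (levyTail νbar) κ) {z : ℂ} (hz : 0 < z.re) :
    ∫ y : ℝ, Complex.exp (-(z * y)) * (((Ioi (0 : ℝ)).indicator κ y : ℝ) : ℂ) = (bernsteinExt νbar z)⁻¹ := by
  have hz0 : z ≠ 0 := fun h => by simp [h] at hz
  have hL := hν.laplace_levyTail hz
  have h := (laplace_convolution hL.1 (hκ.integrable_exp_mul hν hz)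
    (hκ.integral_mul_eq fun x hx => levyTail_of_nonpos νbar hx)).2
  rw [integral_exp_indicator_Ioi hz, hL.2, div_mul_eq_mul_div, div_left_inj' hz0] at h
  exact eq_inv_of_mul_eq_one_right h.symm

/-- The primitive is the convolution of `κ` with the indicator of `(0, ∞)`, whose transform is `1 /
z`. -/
theorem laplace_soninePrimitive (hν : IsCompleteLevyDensity νbar)
    (hκ : IsSonineKernel (levyTail νbar) κ) {z : ℂ} (hz : 0 < z.re) :
    (Integrable fun y : ℝ => Complex.exp (-(z * y)) * (soninePrimitive κ y : ℂ)) ∧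
      ∫ y : ℝ, Complex.exp (-(z * y)) * soninePrimitive κ y =
        (bernsteinExt νbar z)⁻¹ * (1 / z) := by
  have h := laplace_convolution (hκ.integrable_exp_mul hν hz) (integrable_exp_indicator_Ioi hz)
    (c := soninePrimitive κ) fun t => by
      have e : ∀ s, (Ioi 0).indicator κ s * (Ioi (0 : ℝ)).indicator (1 : ℝ → ℝ) (t - s) =
          (Ioo 0 t).indicator κ s := by
        intro s
        by_cases hs : 0 < s
        · by_cases hst : s < t
          · rw [indicator_of_mem (by exact hs), indicator_of_mem (by rw [mem_Ioi]; linarith),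
              indicator_of_mem (s := Ioo 0 t) ⟨hs, hst⟩, Pi.one_apply, mul_one]
          · rw [indicator_of_notMem (a := t - s) (by rw [mem_Ioi]; intro h; exact hst (by linarith)),
              indicator_of_notMem (s := Ioo 0 t) fun h => hst h.2, mul_zero]
        · rw [indicator_of_notMem (s := Ioi 0) hs,
            indicator_of_notMem (s := Ioo 0 t) fun h => hs h.1, zero_mul]
      simp only [e]
      rw [integral_indicator measurableSet_Ioo, soninePrimitive]
  rwa [hκ.laplace_eq hν hz, integral_exp_indicator_Ioi hz] at h

end IsSonineKernel

/-! ### Lower bounds for the increments -/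

theorem ampNu_nonneg (νbar : ℝ → ℝ) (ξ : ℝ) : 0 ≤ ampNu νbar ξ :=
  add_nonneg (sq_nonneg _) (sq_nonneg _)

theorem ampNu_eq_norm_sq (νbar : ℝ → ℝ) (ξ : ℝ) :
    ampNu νbar ξ = ‖bernsteinExt νbar (Complex.I * ξ)‖ ^ 2 := by
  rw [← Complex.normSq_eq_norm_sq, Complex.normSq_apply, ampNu]
  ring

theorem tendsto_add_I_mul (ξ : ℝ) :
    Tendsto (fun n : ℕ => (((1 / ((n : ℝ) + 1) : ℝ) : ℂ) + Complex.I * (ξ : ℂ))) atTop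
      (𝓝 (Complex.I * (ξ : ℂ))) := by
  have := ((Complex.continuous_ofReal.tendsto 0).comp
    (tendsto_one_div_add_atTop_nhds_zero_nat (𝕜 := ℝ))).add_const (Complex.I * (ξ : ℂ))
  simpa only [Complex.ofReal_zero, zero_add] using! this

theorem IsCompleteLevyDensity.le_integral_sq {νbar : ℝ → ℝ} (hν : IsCompleteLevyDensity νbar)
    (hA : CondA νbar) {C β : ℝ} (hC : 0 < C) (hLB : LowerBound (ampNu νbar) C β) {t : ℝ}
    (ht : 0 < t) :
    C / Real.pi * t ^ (1 - β) ≤ ∫ x, kernelIncrement (levyTail νbar) t x ^ 2 := by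
  refine (hν.isL2Kernel hA).le_integral_sq_kernelIncrement (fun z hz => (hν.laplace_levyTail hz).1)
    (fun z hz => (hν.laplace_levyTail hz).2) (fun ξ hξ _ => ?_) (ampNu_nonneg νbar) hLB hC ht
  have hI : Complex.I * (ξ : ℂ) ≠ 0 := mul_ne_zero Complex.I_ne_zero (Complex.ofReal_ne_zero.2 hξ)
  refine ⟨_, (hν.tendsto_bernsteinExt ξ).div (tendsto_add_I_mul ξ) hI, ?_⟩
  rw [norm_div, div_pow, norm_mul, Complex.norm_I, one_mul, Complex.norm_real, Real.norm_eq_abs,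
    sq_abs, ampNu_eq_norm_sq]

theorem IsSonineKernel.le_integral_sq {νbar κ : ℝ → ℝ} (hν : IsCompleteLevyDensity νbar)
    (hκ : IsSonineKernel (levyTail νbar) κ) (hB : CondB κ) {C β : ℝ} (hC : 0 < C)
    (hLB : LowerBound (ampKappa νbar) C β) {t : ℝ} (ht : 0 < t) :
    C / Real.pi * t ^ (1 - β) ≤ ∫ x, kernelIncrement (soninePrimitive κ) t x ^ 2 := by
  refine (hκ.isL2Kernel hB).le_integral_sq_kernelIncrement
    (fun z hz => (hκ.laplace_soninePrimitive hν hz).1)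
    (fun z hz => (hκ.laplace_soninePrimitive hν hz).2) (fun ξ hξ hAξ => ?_)
    (fun ξ => inv_nonneg.2 (ampNu_nonneg νbar ξ)) hLB hC ht
  have hI : Complex.I * (ξ : ℂ) ≠ 0 := mul_ne_zero Complex.I_ne_zero (Complex.ofReal_ne_zero.2 hξ)
  have hφ : bernsteinExt νbar (Complex.I * ξ) ≠ 0 := fun h => hAξ (by
    change (ampNu νbar ξ)⁻¹ = 0
    rw [ampNu_eq_norm_sq, h]
    simp)
  refine ⟨_, ((hν.tendsto_bernsteinExt ξ).inv₀ hφ).mul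
    (tendsto_const_nhds.div (tendsto_add_I_mul ξ) hI), ?_⟩
  change _ = (ampNu νbar ξ)⁻¹ / ξ ^ 2
  rw [norm_mul, norm_inv, norm_div, norm_one, norm_mul, Complex.norm_I, one_mul, Complex.norm_real,
    Real.norm_eq_abs, mul_pow, div_pow, sq_abs, one_pow, ampNu_eq_norm_sq, inv_pow,
    mul_one_div]

/-! ### The local time -/

theorem normConst_eq (k : ℝ → ℝ) (hk : ∀ x, x ≤ 0 → k x = 0) :
    normConst k = (∫ x, kernelIncrement k 1 x ^ 2)⁻¹ := by
  have e : ∀ x, k (max x 0) = k x := fun x => by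
    rcases le_total x 0 with h | h
    · rw [max_eq_right h, hk 0 le_rfl, hk x h]
    · rw [max_eq_left h]
  simp only [normConst, e, kernelIncrement]

/-- Common end of both cases. Continuity of increments in `L²` yields a measurable version;
stationarity turns the lower bound at `t` into one for every pair of times, and the Gaussian
small-ball estimate then applies with `γ = (1 - β)/2`. -/
theorem IsL2Kernel.hasContinuousL2LocalTime {μ : Measure SchwartzDual} (hμ : IsWhiteNoise μ)
    {k q : ℝ → ℝ} (hk : IsL2Kernel k q) {C β : ℝ} (hC : 0 < C) (hβ : β ∈ Ioo (0 : ℝ) 1)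
    (hlow : ∀ t, 0 < t → C / Real.pi * t ^ (1 - β) ≤ ∫ x, kernelIncrement k t x ^ 2)
    {M : (ℝ → ℝ) → ℝ → ℝ} (hM : ∀ t, 0 ≤ t → M ((Ico 0 t).indicator 1) =ᵐ[volume]
      fun x => √(normConst k) * kernelIncrement k t x) :
    HasContinuousL2LocalTime μ M := by
  have hP := hμ.isProbabilityMeasure
  set c := √(normConst k) with hc
  set m : ℝ → ℝ → ℝ := fun t x => c * kernelIncrement k t x with hm
  -- The lower bound at `t = 1` makes the integral inside `normConst` positive, so its inverse is
  -- not the default value `0`.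
  have hcpos : 0 < c := by
    rw [hc, normConst_eq k hk.zero]
    have h1 := hlow 1 one_pos
    rw [Real.one_rpow, mul_one] at h1
    have : 0 < C / Real.pi := by positivity
    exact Real.sqrt_pos.2 (inv_pos.2 (this.trans_le h1))
  have hmL : ∀ t, 0 ≤ t → MemLp (m t) 2 volume := fun t ht =>
    (hk.memLp_kernelIncrement ht).const_mul c
  have hmsub : ∀ s t, eLpNorm (fun x => m s x - m t x) 2 volume =
      ENNReal.ofReal c * eLpNorm (kernelIncrement k (t - s)) 2 volume := by
    intro s t
    rw [← eLpNorm_kernelIncrement_sub k s t hk.aestronglyMeasurable]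
    have : (fun x => m s x - m t x) =
        c • fun x => kernelIncrement k s x - kernelIncrement k t x := by
      ext x
      simp [hm, mul_sub]
    rw [this, eLpNorm_const_smul, Real.enorm_of_nonneg hcpos.le]
  refine ⟨?_, fun X hX => ?_⟩
  · obtain ⟨X, hXm, hXp⟩ := hμ.exists_measurable_version hmL fun ε hε => by
      have hlim : Tendsto (fun h => ENNReal.ofReal c * eLpNorm (kernelIncrement k h) 2 volume)
          (𝓝[≥] 0) (𝓝 0) := by
        have := ENNReal.Tendsto.const_mul (a := ENNReal.ofReal c)
          hk.tendsto_eLpNorm_kernelIncrement (Or.inr ENNReal.ofReal_ne_top)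
        simpa using this
      have hev := hlim.eventually_le_const hε
      obtain ⟨δ, hδ, hsub⟩ := mem_nhdsGE_iff_exists_Icc_subset.1 hev
      refine ⟨δ, hδ, fun s t _ hst h => ?_⟩
      rw [hmsub]
      exact hsub ⟨sub_nonneg.2 hst, h⟩
    exact ⟨X, hXm, fun t ht => (hXp t ht).congr_left (hM t ht).symm⟩
  · have hpair : ∀ t, 0 ≤ t → IsPairing μ (m t) (X t) := fun t ht =>
      (hX.pairing t ht).congr_left (hM t ht)
    have hvar : ∀ s t, 0 ≤ s → 0 ≤ t → s ≠ t →
        c ^ 2 * (C / Real.pi) * |s - t| ^ (1 - β) ≤ ∫ x, (m s x - m t x) ^ 2 := by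
      have hlt : ∀ s t, 0 ≤ s → s < t →
          c ^ 2 * (C / Real.pi) * (t - s) ^ (1 - β) ≤ ∫ x, (m s x - m t x) ^ 2 := by
        intro s t hs hst
        have hL : MemLp (fun x => m s x - m t x) 2 volume := (hmL s hs).sub (hmL t (hs.trans hst.le))
        have h1 := hmsub s t
        rw [eLpNorm_two_eq_ofReal_sqrt hL, eLpNorm_two_eq_ofReal_sqrt
          (hk.memLp_kernelIncrement (sub_nonneg.2 hst.le)), ← ENNReal.ofReal_mul hcpos.le,
          ENNReal.ofReal_eq_ofReal_iff (Real.sqrt_nonneg _) (by positivity)] at h1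
        have h2 := congrArg (· ^ 2) h1
        simp only [mul_pow] at h2
        rw [Real.sq_sqrt (integral_nonneg fun x => sq_nonneg _),
          Real.sq_sqrt (integral_nonneg fun x => sq_nonneg _)] at h2
        rw [h2, mul_assoc]
        exact mul_le_mul_of_nonneg_left (hlow _ (sub_pos.2 hst)) (sq_nonneg c)
      intro s t hs ht hst
      rcases lt_or_gt_of_ne hst with h | h
      · rw [abs_of_neg (sub_neg.2 h), neg_sub]
        exact hlt s t hs h
      · rw [abs_of_pos (sub_pos.2 h)]
        refine (hlt t s ht h).trans (le_of_eq ?_)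
        congr 1
        ext x
        ring
    set D := c ^ 2 * (C / Real.pi) with hD
    have hDpos : 0 < D := by positivity
    refine ae_exists_continuous_localTime hX.measurable (K := ENNReal.ofReal (2 / √D))
      ENNReal.ofReal_ne_top (γ := (1 - β) / 2) (by linarith [hβ.1]) fun s t hs ht hst δ hδ => ?_
    have hd : 0 < |s - t| := abs_pos.2 (sub_ne_zero.2 hst)
    have hv := hvar s t hs ht hst
    have hpos : 0 < D * |s - t| ^ (1 - β) := by positivity
    refine (hμ.measure_abs_sub_le (hpair s hs) (hpair t ht) (hpos.trans_le hv) δ).trans ?_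
    rw [← ENNReal.ofReal_mul (by positivity)]
    refine ENNReal.ofReal_le_ofReal ?_
    have hsq : √(D * |s - t| ^ (1 - β)) = √D * |s - t| ^ ((1 - β) / 2) := by
      rw [Real.sqrt_mul hDpos.le, Real.sqrt_eq_rpow (|s - t| ^ (1 - β)), ← Real.rpow_mul hd.le]
      congr 2
      ring
    calc 2 * δ / √(∫ x, (m s x - m t x) ^ 2) ≤ 2 * δ / √(D * |s - t| ^ (1 - β)) := by
          gcongr
      _ = _ := by
          rw [hsq, Real.rpow_neg hd.le]
          field_simp

end BGM

theorem theoremT2 (νbar : ℝ → ℝ) (hν : BGM.IsCompleteLevyDensity νbar)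
    (hC : BGM.CondC νbar) (hK : BGM.CondK νbar)
    (μ : MeasureTheory.Measure BGM.SchwartzDual) (hμ : BGM.IsWhiteNoise μ)
    (C β : ℝ) (hC₀ : 0 < C) (hβ : β ∈ Set.Ioo (0 : ℝ) 1) :
    (BGM.CondA νbar → BGM.LowerBound (BGM.ampNu νbar) C β →
      BGM.HasContinuousL2LocalTime μ (BGM.opNu νbar)) ∧
    (∀ κ : ℝ → ℝ, BGM.IsSonineKernel (BGM.levyTail νbar) κ → BGM.CondB κ →
      BGM.LowerBound (BGM.ampKappa νbar) C β →
      BGM.HasContinuousL2LocalTime μ (BGM.opKappa κ)) := by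
  refine ⟨fun hA hLB => ?_, fun κ hκ hB hLB => ?_⟩
  · have hk := hν.isL2Kernel hA
    refine hk.hasContinuousL2LocalTime hμ hC₀ hβ (fun t ht => hν.le_integral_sq hA hC₀ hLB ht)
      fun t ht => ?_
    filter_upwards [BGM.rightDerivative_indicator_ae_eq hk.zero
      (fun T _ => hk.integrableOn_Ioo T) ht] with x hx
    rw [BGM.opNu, hx]
  · refine (hκ.isL2Kernel hB).hasContinuousL2LocalTime hμ hC₀ hβ
      (fun t ht => hκ.le_integral_sq hν hB hC₀ hLB ht) fun t ht => Eventually.of_forall fun x => ?_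
    rw [BGM.opKappa, BGM.rightIntegral_indicator_Ico hκ.2.1 ht]
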